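/- Let $\mathbb X,\mathbb Y$ be Polish spaces and consider the partially observed Markov source $$x_{t+1}=f(x_t,w_t),\qquad y_t=g(x_t,r_t),\qquad t\ge 0,$$ with $f,g$ measurable, $(w_t)$ and $(r_t)$ i.i.d. noise processes, and $x_0$, $(w_t)$, $(r_t)$ mutually independent. Fix finite alphabets $\mathcal M_t$, a horizon $T$, a decision space $\mathbb U$ and a bounded non-negative measurable cost $c:\mathbb X\times\mathbb U\to\mathbb R$. A (causal) composite quantization policy $\Pi$ consists of measurable maps giving $q_t\in\mathcal M_t$ as a function of $(y_{[0,t]},q_{[0,t-1]})$; a receiver policy $\gamma$ gives $v_t=\gamma_t(q_{[0,t]})\in\mathbb U$. Let $J(\Pi,\gamma)=E\big[\sum_{t=0}^{T-1}c(x_t,v_t)\big]$; $\Pi$ is optimal if $\inf_\gamma J(\Pi,\gamma)=\inf_{\Pi'}\inf_\gamma J(\Pi',\gamma)$. Let $\pi_t=P(x_t\in\cdot\mid y_{[0,t]})\in\mathcal P(\mathbb X)$ and, under a given policy, $\Xi_t=P(\pi_t\in\cdot\mid q_{[0,t-1]})\in\mathcal P(\mathcal P(\mathbb X))$ (regular conditional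 probabilities), where spaces of probability measures carry the Borel $\sigma$-algebra of the weak topology. (a) Every composite quantization policy $\Pi$ can be replaced, without any loss in performance, by a composite quantization policy $\Pi'$ which uses only $(\Xi_t,\pi_t,t)$ at each time $t$, where $\Xi_t$ is the conditional law under $\Pi'$. That is, from $(\Xi_t,t)$ alone a quantizer $Q_t:\mathcal P(\mathbb X)\to\mathcal M_t$ (a measurable map) is selected, and $q_t=Q_t(\pi_t)$, with $q_t$ jointly measurable in $(\Xi_t,\pi_t)$. "Without loss" means that for every $\gamma$ there is a $\gamma'$ with $J(\Pi',\gamma')\le J(\Pi,\gamma)$. In particular, any optimal policy can be replaced by an optimal policy of this form. (b) $(\Xi_t,Q_t)$ is a controlled Markov chain: there are Markov kernels $K_t(\,\cdot\mid\Xi,Q)$ on $\mathcal P(\mathcal P(\mathbb X))$, not depending on the policy, such that under every policy that selects a quantizer $Q_t:\mathcal P(\mathbb X)\to\mathcal M_t$ as a function of $q_{[0,t-1]}$ and sets $q_t=Q_t(\pi_t)$ for all $t$, one has almost surely $P(\Xi_{t+1}\in B\mid q_{[0,t-1]})=K_t(B\mid\Xi_t,Q_t)$ for all measurable $B$ and all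 $t\ge 0$; consequently also $P(\Xi_{t+1}\in B\mid \Xi_s,Q_s,\ s\le t)=K_t(B\mid\Xi_t,Q_t)$. -/

import Mathlib

open MeasureTheory ProbabilityTheory

noncomputable section

namespace CausalQuantization

/-- A partially observed Markov source `x (t+1) = f (x t) (w t)`, `y t = g (x t) (r t)` on the
probability space `(Ω, P)`: each of the noise processes `(w t)`, `(r t)` is i.i.d., and the initial
state, the process `w` and the process `r` are mutually independent. The prior of the initial state
is the law of `x₀` under `P`. -/
structure Source {Ω : Type*} [MeasurableSpace Ω] (P : Measure Ω)
    (X Y W R : Type*) [MeasurableSpace X] [MeasurableSpace Y] [MeasurableSpace W]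
    [MeasurableSpace R] where
  /-- the state dynamics -/
  f : X → W → X
  /-- the observation channel -/
  g : X → R → Y
  /-- the initial state -/
  x₀ : Ω → X
  /-- the state noise -/
  w : ℕ → Ω → W
  /-- the observation noise -/
  r : ℕ → Ω → R
  measurable_f : Measurable (Function.uncurry f)
  measurable_g : Measurable (Function.uncurry g)
  measurable_x₀ : Measurable x₀
  measurable_w : ∀ t, Measurable (w t)
  measurable_r : ∀ t, Measurable (r t)
  iIndep_w : iIndepFun w P
  iIndep_r : iIndepFun r P
  ident_w : ∀ t, IdentDistrib (w t) (w 0) P P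
  ident_r : ∀ t, IdentDistrib (r t) (r 0) P P
  indep_noises : IndepFun (fun ω t => w t ω) (fun ω t => r t ω) P
  indep_init : IndepFun x₀ (fun ω => ((fun t => w t ω), (fun t => r t ω))) P

/-- Sequences of quantization outputs `q_[0,t-1]`, where the output at time `s` lies in a fixed
alphabet with `m s` elements. -/
abbrev Hist (m : ℕ → ℕ) (t : ℕ) : Type := (s : Fin t) → Fin (m s)

/-- A quantizer: a measurable map from `A` to an alphabet with `n` elements. -/
def Quantizer (A : Type*) [MeasurableSpace A] (n : ℕ) : Type _ :=
  {Q : A → Fin n // Measurable Q}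

/-- A (causal) composite quantization policy: the output at time `t` is a measurable function of
the observations `y_[0,t]` and of the past outputs `q_[0,t-1]`. -/
structure CompositePolicy (Y : Type*) [MeasurableSpace Y] (m : ℕ → ℕ) where
  /-- the map used at time `t` -/
  map : (t : ℕ) → (Fin (t + 1) → Y) → Hist m t → Fin (m t)
  measurable_map : ∀ t,
    Measurable (fun p : (Fin (t + 1) → Y) × Hist m t => map t p.1 p.2)

/-- A causal receiver policy: `v t = γ t q_[0,t]`. Measurability is automatic, since `q_[0,t]`
ranges over a finite set all of whose subsets are measurable. -/
abbrev Receiver (m : ℕ → ℕ) (U : Type*) : Type _ := (t : ℕ) → Hist m (t + 1) → U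

namespace Source

variable {Ω : Type*} [MeasurableSpace Ω] {P : Measure Ω}
  {X Y W R : Type*} [MeasurableSpace X] [MeasurableSpace Y] [MeasurableSpace W] [MeasurableSpace R]
  {m : ℕ → ℕ} {U : Type*}

/-- The state process. -/
def x (S : Source P X Y W R) : ℕ → Ω → X
  | 0 => S.x₀
  | t + 1 => fun ω => S.f (S.x t ω) (S.w t ω)

/-- The observation process. -/
def y (S : Source P X Y W R) (t : ℕ) (ω : Ω) : Y := S.g (S.x t ω) (S.r t ω)

/-- The observation history `y_[0,t]`. -/
def yHist (S : Source P X Y W R) (t : ℕ) (ω : Ω) : Fin (t + 1) → Y := fun s => S.y s ω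

/-- The output history `q_[0,t-1]` generated by a composite quantization policy. -/
def qHist (S : Source P X Y W R) (Γ : CompositePolicy Y m) : (t : ℕ) → Ω → Hist m t
  | 0, _ => fun s => s.elim0
  | t + 1, ω =>
    Fin.snoc (α := fun s : Fin (t + 1) => Fin (m s)) (S.qHist Γ t ω)
      (Γ.map t (S.yHist t ω) (S.qHist Γ t ω))

/-- The expected total cost over the stages `0, …, T - 1` of a policy and a receiver. -/
def cost (S : Source P X Y W R) (c : X → U → ℝ) (T : ℕ) (Γ : CompositePolicy Y m)
    (γ : Receiver m U) : ℝ :=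
  ∫ ω, ∑ t ∈ Finset.range T, c (S.x t ω) (γ t (S.qHist Γ (t + 1) ω)) ∂P

/-- `Γ` attains the infimum of the expected total cost over all composite quantization policies,
the receiver being optimized for each policy. -/
def IsOptimal (S : Source P X Y W R) (c : X → U → ℝ) (T : ℕ) (Γ : CompositePolicy Y m) : Prop :=
  (⨅ γ : Receiver m U, S.cost c T Γ γ) =
    (⨅ Γ' : CompositePolicy Y m, ⨅ γ : Receiver m U, S.cost c T Γ' γ)

lemma measurable_x (S : Source P X Y W R) (t : ℕ) : Measurable (S.x t) := by
  induction t with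
  | zero => exact S.measurable_x₀
  | succ t ih => exact S.measurable_f.comp (ih.prodMk (S.measurable_w t))

lemma measurable_yHist (S : Source P X Y W R) (t : ℕ) : Measurable (S.yHist t) :=
  measurable_pi_lambda _ fun s =>
    S.measurable_g.comp ((S.measurable_x s).prodMk (S.measurable_r s))

section Beliefs

variable [TopologicalSpace X] [PolishSpace X] [BorelSpace X] [Nonempty X] [IsProbabilityMeasure P]

/-- The regular conditional law `π_t = P(x t ∈ · | y_[0,t])` of the state, as a function of the
realization of `y_[0,t]`. -/
def belief (S : Source P X Y W R) (t : ℕ) (η : Fin (t + 1) → Y) : ProbabilityMeasure X :=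
  ⟨condDistrib (S.x t) (S.yHist t) P η, inferInstance⟩

lemma measurable_belief (S : Source P X Y W R) (t : ℕ) : Measurable (S.belief t) :=
  (Kernel.measurable _).subtype_mk

/-- The process `π_t`. -/
def π (S : Source P X Y W R) (t : ℕ) (ω : Ω) : ProbabilityMeasure X := S.belief t (S.yHist t ω)

lemma measurable_π (S : Source P X Y W R) (t : ℕ) : Measurable (S.π t) :=
  (S.measurable_belief t).comp (S.measurable_yHist t)

open Classical in
/-- The regular conditional law `Ξ_t = P(π_t ∈ · | q_[0,t-1])` under the policy `Γ`, as a function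
of the realization `h` of `q_[0,t-1]`. As `q_[0,t-1]` takes finitely many values, it is the
elementary conditional law for every `h` of positive probability; the value for the other `h` is
immaterial. Probability measures carry the σ-algebra generated by the evaluations, which on a
Polish space is the Borel σ-algebra of the weak topology. -/
def Ξ (S : Source P X Y W R) (Γ : CompositePolicy Y m) (t : ℕ) (h : Hist m t) :
    ProbabilityMeasure (ProbabilityMeasure X) :=
  if hp : P (S.qHist Γ t ⁻¹' {h}) ≠ 0 then
    ⟨(P[|S.qHist Γ t ⁻¹' {h}]).map (S.π t),
      haveI := cond_isProbabilityMeasure hp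
      Measure.isProbabilityMeasure_map (S.measurable_π t).aemeasurable⟩
  else
    ⟨P.map (S.π t), Measure.isProbabilityMeasure_map (S.measurable_π t).aemeasurable⟩

/-- The policy `Γ` uses only `(Ξ_t, π_t, t)`: from `(Ξ_t, t)` alone, with `Ξ_t` the conditional law
under `Γ` itself, it picks a quantizer on the space of probability measures, and the output at
time `t` is the value of this quantizer at `π_t`; the output is jointly measurable in
`(Ξ_t, π_t)`. -/
def UsesOnlyBeliefs (S : Source P X Y W R) (Γ : CompositePolicy Y m) : Prop :=
  ∃ Q : (t : ℕ) → ProbabilityMeasure (ProbabilityMeasure X) →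
      Quantizer (ProbabilityMeasure X) (m t),
    (∀ t, Measurable
      (fun p : ProbabilityMeasure (ProbabilityMeasure X) × ProbabilityMeasure X =>
        (Q t p.1).1 p.2)) ∧
    ∀ (t : ℕ) (η : Fin (t + 1) → Y) (h : Hist m t),
      Γ.map t η h = (Q t (S.Ξ Γ t h)).1 (S.belief t η)

/-- At each time `t` the policy `Γ` applies to `π_t` the quantizer `Q t h`, which is selected by
the past outputs `h = q_[0,t-1]`. -/
def AppliesQuantizers (S : Source P X Y W R) (Γ : CompositePolicy Y m)
    (Q : (t : ℕ) → Hist m t → Quantizer (ProbabilityMeasure X) (m t)) : Prop :=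
  ∀ (t : ℕ) (η : Fin (t + 1) → Y) (h : Hist m t), Γ.map t η h = (Q t h).1 (S.belief t η)

/-- `(Ξ_t, Q_t)` is a controlled Markov chain, with state `Ξ_t` and action the quantizer `Q_t`
applied to `π_t`: there are transition kernels `K`, the same for all policies, such that, under
every policy that selects `Q_t` from `q_[0,t-1]`, the conditional law of `Ξ_{t+1}` given
`q_[0,t-1]` is `K t Q_t Ξ_t`. (The whole past `Ξ_0, Q_0, …, Ξ_t, Q_t` is a function of `q_[0,t-1]`,
so this is also the conditional law of `Ξ_{t+1}` given that past.) -/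
def IsControlledMarkovChain (S : Source P X Y W R) (m : ℕ → ℕ) : Prop :=
  ∃ K : (t : ℕ) → Quantizer (ProbabilityMeasure X) (m t) →
      Kernel (ProbabilityMeasure (ProbabilityMeasure X))
        (ProbabilityMeasure (ProbabilityMeasure X)),
    (∀ t Q, IsMarkovKernel (K t Q)) ∧
    ∀ (Γ : CompositePolicy Y m)
      (Q : (t : ℕ) → Hist m t → Quantizer (ProbabilityMeasure X) (m t)),
      S.AppliesQuantizers Γ Q →
      ∀ (t : ℕ) (h : Hist m t), P (S.qHist Γ t ⁻¹' {h}) ≠ 0 →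
      ∀ B : Set (ProbabilityMeasure (ProbabilityMeasure X)), MeasurableSet B →
        (P[|S.qHist Γ t ⁻¹' {h}]) {ω | S.Ξ Γ (t + 1) (S.qHist Γ (t + 1) ω) ∈ B} =
          K t (Q t h) (S.Ξ Γ t h) B

end Beliefs

end Source

end CausalQuantization

end

/-! On an event of the output history, the cost depends only on the unnormalized law of the belief
`π_t` there. Such an event is determined by the observations, so the stage cost integrates against
this law (`setLIntegral_x`). The next law is its image under a fixed kernel (`map_π_succ`), because
`π_{t+1}` is almost surely a filter update of `π_t` and `y_{t+1}`, driven by noise independent of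
the past. This yields (b): given `q_[0,t-1]`, the only randomness left in `Ξ_{t+1}` is the cell of
`Q_t` hit by `π_t`, whose conditional law is `Ξ_t`; and `Ξ_{t+1}` is `Ξ_t` conditioned on that cell
and moved by the belief kernel (`Ξ_succ`).

For (a), a general policy splits the law of `π_t` among the outputs, that is, it quantizes `π_t`
with randomization. With the receiver optimized, costs are infima of integrals, hence concave and
homogeneous in the law (`IsInfLinear`). A randomized quantization is a mixture of deterministic ones
(`exists_mixture`), so by concavity some deterministic quantizer does at least as well
(`exists_quantizer_sum_le`). Backward induction gives quantizers indexed by the output history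
(`exists_selectors_value_le`). To depend on `Ξ_t` alone, the history is treated as a mere label of a
continuation strategy: at `ξ`, the label of least value is used. There are finitely many labels, so
the choice is measurable, and by homogeneity it is also the best one for the unnormalized law
(`exists_usesOnlyBeliefs_sum_le`).

One `Γ'` must serve every receiver `γ`. The receiver is therefore restricted to countably many
actions, taken from an optimal receiver for `Γ` if there is one, and otherwise from a minimizing
sequence. -/

namespace CausalQuantization

/-! ### Concave homogeneous functionals of measures -/

open scoped ENNReal

/-- A functional of measures that is a countable infimum of integrals of measurable functions. -/
def IsInfLinear {Z : Type*} [MeasurableSpace Z] (φ : Measure Z → ℝ≥0∞) : Prop :=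
  ∃ g : ℕ → Z → ℝ≥0∞, (∀ n, Measurable (g n)) ∧ ∀ μ : Measure Z, φ μ = ⨅ n, ∫⁻ z, g n z ∂μ

namespace IsInfLinear

variable {Z : Type*} [MeasurableSpace Z] {φ φ' : Measure Z → ℝ≥0∞}

lemma zero : IsInfLinear (fun _ : Measure Z => 0) :=
  ⟨fun _ _ => 0, fun _ => measurable_const, by simp⟩

lemma add (h : IsInfLinear φ) (h' : IsInfLinear φ') : IsInfLinear (fun μ => φ μ + φ' μ) := by
  obtain ⟨g, hm, e⟩ := h
  obtain ⟨g', hm', e'⟩ := h'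
  -- The two infima run over independent indices, so their sum is one infimum over pairs, enumerated
  -- by `Nat.unpair`.
  refine ⟨fun n z => g n.unpair.1 z + g' n.unpair.2 z, fun n => (hm _).add (hm' _), fun μ => ?_⟩
  simp only [e, e', ENNReal.iInf_add, ENNReal.add_iInf]
  simp_rw [lintegral_add_left (hm _)]
  rw [iInf_comm]
  exact (Nat.surjective_unpair.iInf_comp
    (fun p : ℕ × ℕ => ∫⁻ z, g p.1 z ∂μ + ∫⁻ z, g' p.2 z ∂μ)).trans iInf_prod |>.symm

lemma sum {ι : Type*} (s : Finset ι) {φ : ι → Measure Z → ℝ≥0∞} (h : ∀ i, IsInfLinear (φ i)) :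
    IsInfLinear (fun μ => ∑ i ∈ s, φ i μ) := by
  classical
  induction s using Finset.induction_on with
  | empty => simpa using zero
  | insert i s hi ih => simpa [Finset.sum_insert hi] using (h i).add ih

lemma restrict (h : IsInfLinear φ) {s : Set Z} (hs : MeasurableSet s) :
    IsInfLinear (fun μ => φ (μ.restrict s)) := by
  obtain ⟨g, hm, e⟩ := h
  refine ⟨fun n => s.indicator (g n), fun n => (hm n).indicator hs, fun μ => ?_⟩
  dsimp only
  rw [e]
  exact iInf_congr fun n => (lintegral_indicator hs _).symm

lemma bind (h : IsInfLinear φ) (κ : Kernel Z Z) : IsInfLinear (fun μ => φ (μ.bind κ)) := by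
  obtain ⟨g, hm, e⟩ := h
  refine ⟨fun n z => ∫⁻ z', g n z' ∂(κ z), fun n => (hm n).lintegral_kernel, fun μ => ?_⟩
  dsimp only
  rw [e]
  exact iInf_congr fun n => Measure.lintegral_bind κ.aemeasurable (hm n).aemeasurable

lemma map_zero (h : IsInfLinear φ) : φ 0 = 0 := by
  obtain ⟨g, -, e⟩ := h
  simp [e]

/-- Homogeneity lets values at the law on an event be compared through the normalized conditional
law. -/
lemma map_smul (h : IsInfLinear φ) {c : ℝ≥0∞} (hc : c ≠ ∞) (μ : Measure Z) :
    φ (c • μ) = c * φ μ := by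
  obtain ⟨g, -, e⟩ := h
  simp only [e, lintegral_smul_measure, smul_eq_mul]
  rw [ENNReal.mul_iInf (fun h => absurd h hc)]

lemma measurable (h : IsInfLinear φ) :
    Measurable (fun μ : ProbabilityMeasure Z => φ (μ : Measure Z)) := by
  obtain ⟨g, hm, e⟩ := h
  simp_rw [e]
  exact Measurable.iInf fun n => (Measure.measurable_lintegral (hm n)).comp measurable_subtype_coe

end IsInfLinear

/-! ### Purification of randomized quantizers -/

section Purification

open scoped unitInterval

variable {Z : Type*} [MeasurableSpace Z]

/-- A randomized quantization of a measure is a mixture of deterministic quantizations. -/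
lemma exists_mixture {k : ℕ} [Nonempty (Fin k)] (μ : Fin k → Measure Z)
    [∀ q, IsFiniteMeasure (μ q)] :
    ∃ f : Z → I → Fin k, Measurable (Function.uncurry f) ∧
      ∀ q, ∀ g : Z → ℝ≥0∞, Measurable g →
        Measurable (fun θ => ∫⁻ z, g z ∂((∑ i, μ i).restrict ((fun z => f z θ) ⁻¹' {q}))) ∧
        ∫⁻ z, g z ∂(μ q) =
          ∫⁻ θ, ∫⁻ z, g z ∂((∑ i, μ i).restrict ((fun z => f z θ) ⁻¹' {q})) := by
  classical
  -- The joint measure of point and output; its conditional kernel given the point is the randomized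
  -- quantizer.
  let ρ : Measure (Z × Fin k) := ∑ i, (μ i).map (fun z => (z, i))
  have hρfst : ρ.fst = ∑ i, μ i := by
    ext s hs
    rw [Measure.fst_apply hs]
    simp only [ρ, Measure.finsetSum_apply]
    refine Finset.sum_congr rfl fun i _ => ?_
    rw [Measure.map_apply measurable_prodMk_right (measurable_fst hs)]
    rfl
  -- The randomization is realized by a uniform variable `θ`; fixing `θ` leaves a deterministic
  -- quantizer.
  obtain ⟨f, hf, hfκ⟩ := ρ.condKernel.exists_measurable_map_eq_unitInterval
  have hfq : ∀ q, MeasurableSet {p : Z × I | f p.1 p.2 = q} := fun q => hf (measurableSet_singleton q)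
  have hft : ∀ θ, Measurable (fun z => f z θ) := fun θ => hf.comp measurable_prodMk_right
  refine ⟨f, hf, fun q g hg => ?_⟩
  have hrw : ∀ θ, ∫⁻ z, g z ∂((∑ i, μ i).restrict ((fun z => f z θ) ⁻¹' {q})) =
      ∫⁻ z, {p : Z × I | f p.1 p.2 = q}.indicator (fun p => g p.1) (z, θ) ∂(∑ i, μ i) := by
    intro θ
    rw [← lintegral_indicator (hft θ (measurableSet_singleton q))]
    rfl
  have hmeas : Measurable ({p : Z × I | f p.1 p.2 = q}.indicator (fun p => g p.1)) :=
    (hg.comp measurable_fst).indicator (hfq q)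
  simp_rw [hrw]
  refine ⟨hmeas.lintegral_prod_left', ?_⟩
  rw [← lintegral_lintegral_swap (f := fun z θ =>
    {p : Z × I | f p.1 p.2 = q}.indicator (fun p => g p.1) (z, θ)) hmeas.aemeasurable]
  have h1 : ∫⁻ z, g z ∂(μ q) = ∫⁻ p, g p.1 * ({q} : Set (Fin k)).indicator 1 p.2 ∂ρ := by
    have hm : Measurable (fun p : Z × Fin k => g p.1 * ({q} : Set (Fin k)).indicator 1 p.2) :=
      (hg.comp measurable_fst).mul
        ((measurable_one.indicator (measurableSet_singleton q)).comp measurable_snd)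
    simp only [ρ, lintegral_finsetSum_measure]
    rw [Finset.sum_eq_single q]
    · rw [lintegral_map hm measurable_prodMk_right]; simp
    · intro i _ hi
      rw [lintegral_map hm measurable_prodMk_right]; simp [hi]
    · simp
  rw [h1, ← ρ.disintegrate ρ.condKernel, Measure.lintegral_compProd, hρfst]
  · refine lintegral_congr fun z => ?_
    rw [← hfκ z, lintegral_map _ hf.of_uncurry_left]
    · refine lintegral_congr fun θ => ?_
      by_cases h : f z θ = q <;> simp [h]
    · exact (measurable_const (a := g z)).mul
        (measurable_one.indicator (measurableSet_singleton q))
  · exact (hg.comp measurable_fst).mul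
      ((measurable_one.indicator (measurableSet_singleton q)).comp measurable_snd)

/-- By concavity, the average over `θ` of the cost of the quantizer `f · θ` is at most the cost of
the mixture, and some `θ` does no worse than the average. -/
lemma exists_quantizer_sum_le {k : ℕ} [Nonempty (Fin k)] (μ : Fin k → Measure Z)
    [∀ q, IsFiniteMeasure (μ q)] {φ : Fin k → Measure Z → ℝ≥0∞} (hφ : ∀ q, IsInfLinear (φ q)) :
    ∃ Q : Quantizer Z k, ∑ q, φ q ((∑ i, μ i).restrict (Q.1 ⁻¹' {q})) ≤ ∑ q, φ q (μ q) := by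
  obtain ⟨f, hf, hmix⟩ := exists_mixture μ
  choose u hum hu using hφ
  let F : Fin k → I → ℝ≥0∞ := fun q θ =>
    ⨅ n, ∫⁻ z, u q n z ∂((∑ i, μ i).restrict ((fun z => f z θ) ⁻¹' {q}))
  have hF : ∀ q, Measurable (F q) := fun q =>
    Measurable.iInf fun n => (hmix q _ (hum q n)).1
  obtain ⟨θ, hθ⟩ := exists_le_lintegral (μ := (volume : Measure I))
    (f := fun θ => ∑ q, F q θ) (Finset.measurable_sum _ fun q _ => hF q).aemeasurable
  refine ⟨⟨fun z => f z θ, hf.comp measurable_prodMk_right⟩, ?_⟩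
  calc ∑ q, φ q ((∑ i, μ i).restrict ((fun z => f z θ) ⁻¹' {q}))
      = ∑ q, F q θ := Finset.sum_congr rfl fun q _ => hu q _
    _ ≤ ∫⁻ θ, ∑ q, F q θ := hθ
    _ = ∑ q, ∫⁻ θ, F q θ := lintegral_finsetSum _ fun q _ => hF q
    _ ≤ ∑ q, φ q (μ q) := Finset.sum_le_sum fun q _ => by
        rw [hu]
        refine le_iInf fun n => ?_
        rw [(hmix q _ (hum q n)).2]
        exact lintegral_mono fun θ => iInf_le _ n

end Purification

/-! ### Measurable selection, exchange of infimum and sum, grouping of independent variables -/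

lemma exists_measurable_argmin {H K : Type*} [Finite H] [Nonempty H] [MeasurableSpace H]
    [MeasurableSingletonClass H] [MeasurableSpace K] {F : H → K → ℝ≥0∞}
    (hF : ∀ h, Measurable (F h)) :
    ∃ b : K → H, Measurable b ∧ ∀ k h, F (b k) k ≤ F h k := by
  classical
  have := Fintype.ofFinite H
  suffices ∀ s : Finset H, ∃ b : K → H, Measurable b ∧ ∀ k, ∀ h ∈ s, F (b k) k ≤ F h k by
    obtain ⟨b, hb, hmin⟩ := this Finset.univ
    exact ⟨b, hb, fun k h => hmin k h (Finset.mem_univ h)⟩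
  intro s
  induction s using Finset.induction_on with
  | empty => exact ⟨fun _ => Classical.arbitrary H, measurable_const, by simp⟩
  | insert h s _ ih =>
    obtain ⟨b, hb, hmin⟩ := ih
    have hFb : Measurable (fun k => F (b k) k) := by
      have : Measurable (fun p : H × K => F p.1 p.2) := measurable_from_prod_countable_right hF
      exact this.comp (hb.prodMk measurable_id)
    refine ⟨fun k => if F h k ≤ F (b k) k then h else b k,
      Measurable.ite (measurableSet_le (hF h) hFb) measurable_const hb, fun k h' hh' => ?_⟩
    dsimp only
    split_ifs with hle
    · rcases Finset.mem_insert.1 hh' with rfl | hmem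
      · exact le_rfl
      · exact hle.trans (hmin k h' hmem)
    · rcases Finset.mem_insert.1 hh' with rfl | hmem
      · exact (not_le.1 hle).le
      · exact hmin k h' hmem

lemma exists_sum_lt_of_sum_iInf_lt {ι : Type*} (s : Finset ι) (F : ι → ℕ → ℝ≥0∞) {b : ℝ≥0∞}
    (h : ∑ i ∈ s, ⨅ n, F i n < b) : ∃ f : ι → ℕ, ∑ i ∈ s, F i (f i) < b := by
  have key : ⨅ f : ι → ℕ, ∑ i ∈ s, F i (f i) = ∑ i ∈ s, ⨅ f : ι → ℕ, F i (f i) := by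
    refine ENNReal.iInf_sum fun _ f f' => ?_
    -- Two index choices are dominated by their coordinatewise better one; this directedness lets
    -- the infimum pass through the finite sum.
    refine ⟨fun i => if F i (f i) ≤ F i (f' i) then f i else f' i, fun i _ => ?_⟩
    dsimp only
    split_ifs with hle
    · exact ⟨le_rfl, hle⟩
    · exact ⟨(not_le.1 hle).le, le_rfl⟩
  have hev : ∀ i, ⨅ f : ι → ℕ, F i (f i) = ⨅ n, F i n := fun i =>
    (Function.surjective_eval (β := fun _ : ι => ℕ) i).iInf_comp (F i)
  simp_rw [hev] at key
  rw [← key, iInf_lt_iff] at h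
  exact h

lemma indepFun_prodMk_of_indepFun {Ω A B C : Type*} [MeasurableSpace Ω] [MeasurableSpace A]
    [MeasurableSpace B] [MeasurableSpace C] {P : Measure Ω} [IsFiniteMeasure P]
    {a : Ω → A} {b : Ω → B} {c : Ω → C} (ha : Measurable a) (hb : Measurable b)
    (hc : Measurable c) (h : IndepFun a (fun ω => (b ω, c ω)) P) (hbc : IndepFun b c P) :
    IndepFun (fun ω => (a ω, b ω)) c P := by
  have hab : IndepFun a b P := h.comp measurable_id measurable_fst
  rw [indepFun_iff_map_prod_eq_prod_map_map (by fun_prop) (by fun_prop)] at h hbc hab ⊢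
  rw [hab, ← MeasurableEquiv.prodAssoc.map_measurableEquiv_injective.eq_iff,
    Measure.map_map (by fun_prop) (by fun_prop), Measure.prodAssoc_prod, ← hbc, ← h]
  rfl

/-! ### Independence of the fresh noise from the past -/

namespace Source

variable {Ω : Type*} [MeasurableSpace Ω] {P : Measure Ω}
  {X Y W R : Type*} [MeasurableSpace X] [MeasurableSpace Y] [MeasurableSpace W] [MeasurableSpace R]
  {m : ℕ → ℕ} {U : Type*}

/-- The initial state and all the noise that has entered up to the observation at time `t`. -/
def past (S : Source P X Y W R) (t : ℕ) (ω : Ω) :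
    X × ((Finset.range (t + 1) → R) × (Finset.range t → W)) :=
  (S.x₀ ω, ((fun i => S.r i ω), (fun i => S.w i ω)))

/-- Within each noise process this is the i.i.d. assumption, across the two it is `indep_noises`,
and `x₀` is added last by `indep_init`; `indepFun_prodMk_of_indepFun` does each regrouping. -/
lemma indepFun_past [IsProbabilityMeasure P] (S : Source P X Y W R) (t : ℕ) :
    IndepFun (S.past t) (fun ω => (S.w t ω, S.r (t + 1) ω)) P := by
  have hmr : Measurable fun ω (i : Finset.range (t + 1)) => S.r i ω :=
    measurable_pi_lambda _ fun i => S.measurable_r i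
  have hmw : Measurable fun ω (i : Finset.range t) => S.w i ω :=
    measurable_pi_lambda _ fun i => S.measurable_w i
  have hw := S.measurable_w t
  have hr := S.measurable_r (t + 1)
  have hww : IndepFun (fun ω (i : Finset.range t) => S.w i ω) (S.w t) P :=
    (S.iIndep_w.indepFun_finset (Finset.range t) {t} (by simp) S.measurable_w).comp
      measurable_id (measurable_pi_apply (⟨t, by simp⟩ : ({t} : Finset ℕ)))
  have hrr : IndepFun (fun ω (i : Finset.range (t + 1)) => S.r i ω) (S.r (t + 1)) P :=
    (S.iIndep_r.indepFun_finset (Finset.range (t + 1)) {t + 1} (by simp) S.measurable_r).comp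
      measurable_id (measurable_pi_apply (⟨t + 1, by simp⟩ : ({t + 1} : Finset ℕ)))
  have hpr : Measurable fun (a : ℕ → R) => ((fun i : Finset.range (t + 1) => a i), a (t + 1)) :=
    (measurable_pi_lambda _ fun i => measurable_pi_apply _).prodMk (measurable_pi_apply _)
  have hpw : Measurable fun (a : ℕ → W) => ((fun i : Finset.range t => a i), a t) :=
    (measurable_pi_lambda _ fun i => measurable_pi_apply _).prodMk (measurable_pi_apply _)
  have hwr : IndepFun (fun ω => ((fun i : Finset.range t => S.w i ω), S.w t ω))
      (fun ω => ((fun i : Finset.range (t + 1) => S.r i ω), S.r (t + 1) ω)) P :=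
    S.indep_noises.comp hpw hpr
  have h1 : IndepFun (fun ω => (((fun i : Finset.range (t + 1) => S.r i ω)),
      (fun i : Finset.range t => S.w i ω))) (S.w t) P :=
    indepFun_prodMk_of_indepFun hmr hmw hw
      (hwr.symm.comp measurable_fst measurable_id) hww
  have h2 : IndepFun (fun ω => (((fun i : Finset.range t => S.w i ω), S.w t ω),
      (fun i : Finset.range (t + 1) => S.r i ω))) (S.r (t + 1)) P :=
    indepFun_prodMk_of_indepFun (hmw.prodMk hw) hmr hr hwr hrr
  have h3 : IndepFun (fun ω => (S.r (t + 1) ω, S.w t ω))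
      (fun ω => (((fun i : Finset.range (t + 1) => S.r i ω)),
        (fun i : Finset.range t => S.w i ω))) P := by
    refine indepFun_prodMk_of_indepFun hr hw (hmr.prodMk hmw) ?_ h1.symm
    exact h2.symm.comp measurable_id
      (φ := id) (ψ := fun p : ((Finset.range t → W) × W) × (Finset.range (t + 1) → R) =>
        (p.1.2, (p.2, p.1.1))) (by fun_prop)
  refine indepFun_prodMk_of_indepFun S.measurable_x₀ (hmr.prodMk hmw) (hw.prodMk hr) ?_
    (h3.symm.comp measurable_id measurable_swap)
  exact S.indep_init.comp (φ := id)
    (ψ := fun p : (ℕ → W) × (ℕ → R) => (((fun i : Finset.range (t + 1) => p.2 i),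
      (fun i : Finset.range t => p.1 i)), (p.1 t, p.2 (t + 1)))) measurable_id (by fun_prop)

lemma measurable_x_past (S : Source P X Y W R) {s t : ℕ} (h : s ≤ t) :
    Measurable[MeasurableSpace.comap (S.past t) inferInstance] (S.x s) := by
  induction s with
  | zero => exact measurable_fst.comp (comap_measurable (S.past t))
  | succ s ih =>
    refine S.measurable_f.comp (Measurable.prodMk (ih (by omega)) ?_)
    exact ((measurable_pi_apply (⟨s, by simp; omega⟩ : Finset.range t)).comp
      (measurable_snd.comp measurable_snd)).comp (comap_measurable (S.past t))

lemma measurable_yHist_past (S : Source P X Y W R) (t : ℕ) :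
    Measurable[MeasurableSpace.comap (S.past t) inferInstance] (S.yHist t) := by
  refine @measurable_pi_lambda _ _ _ (_) _ _ fun s => ?_
  refine S.measurable_g.comp (Measurable.prodMk (S.measurable_x_past (Nat.lt_succ_iff.1 s.2)) ?_)
  exact ((measurable_pi_apply (⟨s, Finset.mem_range.2 s.2⟩ : Finset.range (t + 1))).comp
      (measurable_fst.comp measurable_snd)).comp (comap_measurable (S.past t))

lemma indepFun_yHist_x [IsProbabilityMeasure P] (S : Source P X Y W R) (t : ℕ) :
    IndepFun (fun ω => (S.yHist t ω, S.x t ω)) (fun ω => (S.w t ω, S.r (t + 1) ω)) P := by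
  have h := S.indepFun_past t
  rw [IndepFun_iff_Indep] at h ⊢
  refine indep_of_indep_of_le_left h ?_
  rw [← measurable_iff_comap_le]
  exact (S.measurable_yHist_past t).prodMk (S.measurable_x_past le_rfl)

lemma measurable_step (S : Source P X Y W R) :
    Measurable (fun p : X × (W × R) => (S.g (S.f p.1 p.2.1) p.2.2, S.f p.1 p.2.1)) := by
  have hf : Measurable (fun p : X × (W × R) => S.f p.1 p.2.1) :=
    S.measurable_f.comp (measurable_fst.prodMk (measurable_fst.comp measurable_snd))
  exact (S.measurable_g.comp (hf.prodMk (measurable_snd.comp measurable_snd))).prodMk hf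

lemma measurable_noise (S : Source P X Y W R) (t : ℕ) :
    Measurable (fun ω => (S.w t ω, S.r (t + 1) ω)) :=
  (S.measurable_w t).prodMk (S.measurable_r (t + 1))

lemma measurable_snoc (t : ℕ) : Measurable (fun p : (Fin (t + 1) → Y) × Y =>
    (Fin.snoc p.1 p.2 : Fin (t + 2) → Y)) := by
  refine measurable_pi_lambda _ fun i => ?_
  refine Fin.lastCases ?_ (fun j => ?_) i
  · simpa using measurable_snd
  · simp only [Fin.snoc_castSucc]
    exact (measurable_pi_apply j).comp measurable_fst

lemma yHist_succ (S : Source P X Y W R) (t : ℕ) (ω : Ω) :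
    S.yHist (t + 1) ω = Fin.snoc (S.yHist t ω) (S.y (t + 1) ω) := by
  funext i
  refine Fin.lastCases ?_ (fun j => ?_) i
  · simp [yHist]
  · simp [yHist]

/-! ### One-step prediction and the filter recursion -/

section Step

variable [IsProbabilityMeasure P]

/-- The kernel that draws a point from a given probability measure. -/
noncomputable def drawKernel (X : Type*) [MeasurableSpace X] : Kernel (ProbabilityMeasure X) X :=
  ⟨fun z => (z : Measure X), measurable_subtype_coe⟩

instance isMarkovKernel_drawKernel : IsMarkovKernel (drawKernel X) :=
  ⟨fun z => inferInstanceAs (IsProbabilityMeasure (z : Measure X))⟩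

/-- The joint law of the next observation and the next state, given the law of the state. -/
noncomputable def stepKernel (S : Source P X Y W R) (t : ℕ) : Kernel (ProbabilityMeasure X) (Y × X) :=
  (drawKernel X ×ₖ
    Kernel.const _ (P.map fun ω => (S.w t ω, S.r (t + 1) ω))).map
      (fun p => (S.g (S.f p.1 p.2.1) p.2.2, S.f p.1 p.2.1))

instance isProbabilityMeasure_noise (S : Source P X Y W R) (t : ℕ) :
    IsProbabilityMeasure (P.map fun ω => (S.w t ω, S.r (t + 1) ω)) :=
  Measure.isProbabilityMeasure_map (S.measurable_noise t).aemeasurable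

instance isMarkovKernel_stepKernel (S : Source P X Y W R) (t : ℕ) :
    IsMarkovKernel (S.stepKernel t) :=
  Kernel.IsMarkovKernel.map _ S.measurable_step

lemma lintegral_stepKernel (S : Source P X Y W R) (t : ℕ) (z : ProbabilityMeasure X)
    {h : Y × X → ℝ≥0∞} (hh : Measurable h) :
    ∫⁻ p, h p ∂(S.stepKernel t z) = ∫⁻ x, ∫⁻ n, h (S.g (S.f x n.1) n.2, S.f x n.1)
      ∂(P.map fun ω => (S.w t ω, S.r (t + 1) ω)) ∂(z : Measure X) := by
  rw [stepKernel, Kernel.map_apply _ S.measurable_step, lintegral_map hh S.measurable_step,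
    Kernel.prod_apply, Kernel.const_apply]
  exact lintegral_prod _ (hh.comp S.measurable_step).aemeasurable

end Step

section Filtering

variable [TopologicalSpace X] [PolishSpace X] [BorelSpace X] [Nonempty X] [IsProbabilityMeasure P]

lemma lintegral_belief (S : Source P X Y W R) (t : ℕ)
    {h : (Fin (t + 1) → Y) × X → ℝ≥0∞} (hh : Measurable h) :
    ∫⁻ ω, h (S.yHist t ω, S.x t ω) ∂P =
      ∫⁻ ω, ∫⁻ x, h (S.yHist t ω, x) ∂(S.π t ω : Measure X) ∂P := by
  have hy := S.measurable_yHist t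
  have hx := S.measurable_x t
  rw [← lintegral_map (μ := P) (g := fun ω => (S.yHist t ω, S.x t ω)) hh (hy.prodMk hx),
    ← compProd_map_condDistrib hx.aemeasurable, Measure.lintegral_compProd hh,
    lintegral_map _ hy]
  · rfl
  · exact hh.lintegral_kernel_prod_right'

/-- The fresh noise is independent of `(y_[0,t], x_t)` and integrates out first; then `x_t` is
averaged under its conditional law `π_t`. -/
lemma lintegral_succ (S : Source P X Y W R) (t : ℕ)
    {h : (Fin (t + 1) → Y) × (Y × X) → ℝ≥0∞} (hh : Measurable h) :
    ∫⁻ ω, h (S.yHist t ω, (S.y (t + 1) ω, S.x (t + 1) ω)) ∂P =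
      ∫⁻ ω, ∫⁻ p, h (S.yHist t ω, p) ∂(S.stepKernel t (S.π t ω)) ∂P := by
  have hyx := (S.measurable_yHist t).prodMk (S.measurable_x t)
  have hn := S.measurable_noise t
  have hstep : Measurable (fun q : ((Fin (t + 1) → Y) × X) × (W × R) =>
      h (q.1.1, (S.g (S.f q.1.2 q.2.1) q.2.2, S.f q.1.2 q.2.1))) :=
    hh.comp ((measurable_fst.comp measurable_fst).prodMk
      (S.measurable_step.comp ((measurable_snd.comp measurable_fst).prodMk measurable_snd)))
  have hlaw := (S.indepFun_yHist_x t).map_prod_eq_prod_map_map hyx.aemeasurable hn.aemeasurable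
  calc ∫⁻ ω, h (S.yHist t ω, (S.y (t + 1) ω, S.x (t + 1) ω)) ∂P
      = ∫⁻ q, h (q.1.1, (S.g (S.f q.1.2 q.2.1) q.2.2, S.f q.1.2 q.2.1))
          ∂(P.map fun ω => ((S.yHist t ω, S.x t ω), (S.w t ω, S.r (t + 1) ω))) :=
        (lintegral_map hstep (hyx.prodMk hn)).symm
    _ = ∫⁻ ω, ∫⁻ n, h (S.yHist t ω, (S.g (S.f (S.x t ω) n.1) n.2, S.f (S.x t ω) n.1))
          ∂(P.map fun ω => (S.w t ω, S.r (t + 1) ω)) ∂P := by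
        rw [hlaw, lintegral_prod _ hstep.aemeasurable,
          lintegral_map hstep.lintegral_prod_right' hyx]
    _ = _ := by
        rw [S.lintegral_belief t (h := fun a => ∫⁻ n, h (a.1, (S.g (S.f a.2 n.1) n.2, S.f a.2 n.1))
          ∂(P.map fun ω => (S.w t ω, S.r (t + 1) ω))) hstep.lintegral_prod_right']
        refine lintegral_congr fun ω => ?_
        rw [S.lintegral_stepKernel t _ (h := fun p => h (S.yHist t ω, p))
          (hh.comp measurable_prodMk_left)]

lemma setLIntegral_x (S : Source P X Y W R) (t : ℕ) {E : Set Ω}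
    (hE : MeasurableSet[MeasurableSpace.comap (S.yHist t) inferInstance] E)
    {h : X → ℝ≥0∞} (hh : Measurable h) :
    ∫⁻ ω in E, h (S.x t ω) ∂P =
      ∫⁻ z, ∫⁻ x, h x ∂(z : Measure X) ∂((P.restrict E).map (S.π t)) := by
  obtain ⟨E, hE, rfl⟩ := hE
  have hEm := S.measurable_yHist t hE
  have hm : Measurable (fun q : (Fin (t + 1) → Y) × X => E.indicator 1 q.1 * h q.2) :=
    ((measurable_one.indicator hE).comp measurable_fst).mul (hh.comp measurable_snd)
  have hl : Measurable (fun z : ProbabilityMeasure X => ∫⁻ x, h x ∂(z : Measure X)) :=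
    (Measure.measurable_lintegral hh).comp measurable_subtype_coe
  rw [lintegral_map hl (S.measurable_π t)]
  have hind : ∀ F : Ω → ℝ≥0∞, ∫⁻ ω in S.yHist t ⁻¹' E, F ω ∂P =
      ∫⁻ ω, E.indicator 1 (S.yHist t ω) * F ω ∂P := fun F => by
    rw [← lintegral_indicator hEm]
    refine lintegral_congr fun ω => ?_
    by_cases hω : S.yHist t ω ∈ E <;> simp [hω]
  rw [hind, hind, S.lintegral_belief t hm]
  refine lintegral_congr fun ω => ?_
  rw [← lintegral_const_mul _ hh]

variable [MeasurableSpace.CountablyGenerated Y]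

/-- The filter update: the law of the next state given its predecessor's law and the next
observation. -/
noncomputable def filterMap (S : Source P X Y W R) (t : ℕ) (p : ProbabilityMeasure X × Y) :
    ProbabilityMeasure X :=
  ⟨(S.stepKernel t).condKernel p, inferInstance⟩

lemma measurable_filterMap (S : Source P X Y W R) (t : ℕ) : Measurable (S.filterMap t) :=
  (Kernel.measurable _).subtype_mk

/-- Conditional laws are almost surely unique, so it suffices that the step kernel at `π_t`,
disintegrated along `y_{t+1}`, reproduces the joint law of `(y_[0,t+1], x_{t+1})`. -/
lemma π_succ_ae (S : Source P X Y W R) (t : ℕ) :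
    ∀ᵐ ω ∂P, S.π (t + 1) ω = S.filterMap t (S.π t ω, S.y (t + 1) ω) := by
  have hφ : Measurable (fun η : Fin (t + 2) → Y =>
      (S.belief t (Fin.init η), η (Fin.last (t + 1)))) :=
    ((S.measurable_belief t).comp
      (measurable_pi_lambda _ fun i => measurable_pi_apply _)).prodMk (measurable_pi_apply _)
  let κ : Kernel (Fin (t + 2) → Y) X := ((S.stepKernel t).condKernel).comap _ hφ
  have key : P.map (fun ω => (S.yHist (t + 1) ω, S.x (t + 1) ω)) =
      P.map (S.yHist (t + 1)) ⊗ₘ κ := by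
    refine Measure.ext_of_lintegral _ fun h hh => ?_
    have hy := S.measurable_yHist (t + 1)
    have hsn : Measurable (fun q : (Fin (t + 1) → Y) × (Y × X) =>
        ((Fin.snoc q.1 q.2.1 : Fin (t + 2) → Y), q.2.2)) :=
      ((measurable_snoc t).comp (measurable_fst.prodMk
        (measurable_fst.comp measurable_snd))).prodMk (measurable_snd.comp measurable_snd)
    have hκ : Measurable (fun η => ∫⁻ x, h (η, x) ∂(κ η)) := hh.lintegral_kernel_prod_right'
    have hκ' : Measurable (fun q : (Fin (t + 1) → Y) × (Y × X) =>
        ∫⁻ x, h ((Fin.snoc q.1 q.2.1 : Fin (t + 2) → Y), x) ∂(κ (Fin.snoc q.1 q.2.1))) :=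
      hκ.comp (measurable_fst.comp hsn)
    rw [lintegral_map hh (hy.prodMk (S.measurable_x _)), Measure.lintegral_compProd hh,
      lintegral_map hκ hy]
    simp_rw [yHist_succ]
    rw [S.lintegral_succ t (h := fun q => h ((Fin.snoc q.1 q.2.1 : Fin (t + 2) → Y), q.2.2))
      (hh.comp hsn), S.lintegral_succ t hκ']
    refine lintegral_congr fun ω => ?_
    have hh2 : Measurable fun p : Y × X =>
        h ((Fin.snoc (S.yHist t ω) p.1 : Fin (t + 2) → Y), p.2) :=
      (hh.comp hsn).comp measurable_prodMk_left
    have hs : Measurable fun y : Y => (Fin.snoc (S.yHist t ω) y : Fin (t + 2) → Y) :=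
      (measurable_snoc t).comp (measurable_prodMk_left (x := S.yHist t ω))
    have hκ2 : Measurable fun y : Y => ∫⁻ x, h ((Fin.snoc (S.yHist t ω) y : Fin (t + 2) → Y), x)
        ∂(κ (Fin.snoc (S.yHist t ω) y)) :=
      hκ.comp hs
    rw [← (lintegral_map hκ2 measurable_fst : _ = ∫⁻ p : Y × X, _ ∂(S.stepKernel t (S.π t ω))),
      ← Kernel.fst_apply]
    conv_lhs => rw [← (S.stepKernel t).disintegrate (S.stepKernel t).condKernel]
    rw [Kernel.lintegral_compProd _ _ _ hh2]
    refine lintegral_congr fun y => ?_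
    simp [κ, Kernel.comap_apply, π]
  have hae := condDistrib_ae_eq_of_measure_eq_compProd (S.yHist (t + 1))
    (S.measurable_x (t + 1)).aemeasurable key
  filter_upwards [ae_of_ae_map (S.measurable_yHist (t + 1)).aemeasurable hae] with ω hω
  refine Subtype.ext ?_
  refine hω.trans ?_
  simp [κ, Kernel.comap_apply, filterMap, yHist_succ, π]

/-- The transition kernel of the belief process. -/
noncomputable def beliefKernel (S : Source P X Y W R) (t : ℕ) :
    Kernel (ProbabilityMeasure X) (ProbabilityMeasure X) :=
  (Kernel.id ×ₖ S.stepKernel t).map (fun p => S.filterMap t (p.1, p.2.1))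

lemma measurable_filterMap_step (S : Source P X Y W R) (t : ℕ) :
    Measurable (fun p : ProbabilityMeasure X × (Y × X) => S.filterMap t (p.1, p.2.1)) :=
  (S.measurable_filterMap t).comp (measurable_fst.prodMk (measurable_fst.comp measurable_snd))

instance isMarkovKernel_beliefKernel (S : Source P X Y W R) (t : ℕ) :
    IsMarkovKernel (S.beliefKernel t) :=
  Kernel.IsMarkovKernel.map _ (S.measurable_filterMap_step t)

lemma lintegral_beliefKernel (S : Source P X Y W R) (t : ℕ) (z : ProbabilityMeasure X)
    {h : ProbabilityMeasure X → ℝ≥0∞} (hh : Measurable h) :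
    ∫⁻ z', h z' ∂(S.beliefKernel t z) = ∫⁻ p, h (S.filterMap t (z, p.1)) ∂(S.stepKernel t z) := by
  have hm := S.measurable_filterMap_step t
  rw [beliefKernel, Kernel.map_apply _ hm, lintegral_map hh hm, Kernel.prod_apply,
    Kernel.id_apply, lintegral_prod
      (fun p : ProbabilityMeasure X × (Y × X) => h (S.filterMap t (p.1, p.2.1)))
      (hh.comp hm).aemeasurable, lintegral_dirac']
  exact (hh.comp hm).lintegral_prod_right'

/-- The indicator of `E` is a function of `y_[0,t]`, so it can be carried through the filter update
and the one-step prediction. -/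
lemma map_π_succ (S : Source P X Y W R) (t : ℕ) {E : Set Ω}
    (hE : MeasurableSet[MeasurableSpace.comap (S.yHist t) inferInstance] E) :
    (P.restrict E).map (S.π (t + 1)) = ((P.restrict E).map (S.π t)).bind (S.beliefKernel t) := by
  obtain ⟨E, hE, rfl⟩ := hE
  have hEm := S.measurable_yHist t hE
  refine Measure.ext_of_lintegral _ fun h hh => ?_
  rw [lintegral_map hh (S.measurable_π _), Measure.lintegral_bind (Kernel.aemeasurable _)
    hh.aemeasurable, lintegral_map hh.lintegral_kernel (S.measurable_π t)]
  have hm : Measurable (fun q : (Fin (t + 1) → Y) × (Y × X) =>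
      E.indicator 1 q.1 * h (S.filterMap t (S.belief t q.1, q.2.1))) :=
    ((measurable_one.indicator hE).comp measurable_fst).mul
      (hh.comp ((S.measurable_filterMap_step t).comp
        (((S.measurable_belief t).comp measurable_fst).prodMk measurable_snd)))
  have hind : ∀ F : Ω → ℝ≥0∞, ∫⁻ ω in S.yHist t ⁻¹' E, F ω ∂P =
      ∫⁻ ω, E.indicator 1 (S.yHist t ω) * F ω ∂P := fun F => by
    rw [← lintegral_indicator hEm]
    refine lintegral_congr fun ω => ?_
    by_cases hω : S.yHist t ω ∈ E <;> simp [hω]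
  rw [hind, hind]
  calc ∫⁻ ω, E.indicator 1 (S.yHist t ω) * h (S.π (t + 1) ω) ∂P
      = ∫⁻ ω, E.indicator 1 (S.yHist t ω) *
          h (S.filterMap t (S.belief t (S.yHist t ω), S.y (t + 1) ω)) ∂P := by
        refine lintegral_congr_ae ?_
        filter_upwards [S.π_succ_ae t] with ω hω
        rw [hω, π]
    _ = _ := by
        rw [S.lintegral_succ t hm]
        refine lintegral_congr fun ω => ?_
        rw [S.lintegral_beliefKernel t _ hh, ← lintegral_const_mul]
        · rfl
        · exact hh.comp ((S.measurable_filterMap_step t).comp measurable_prodMk_left)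

end Filtering

end Source

/-! ### Splitting off the last output -/

section Histories

variable {m : ℕ → ℕ} {t : ℕ}

/-- Append an output to an output history. -/
def Hist.snoc (h : Hist m t) (q : Fin (m t)) : Hist m (t + 1) :=
  Fin.snoc (α := fun s : Fin (t + 1) => Fin (m s)) h q

/-- The outputs before the last one. -/
def Hist.init (h : Hist m (t + 1)) : Hist m t := fun s => h s.castSucc

/-- The last output. -/
def Hist.last (h : Hist m (t + 1)) : Fin (m t) := h (Fin.last t)

@[simp] lemma Hist.init_snoc (h : Hist m t) (q : Fin (m t)) : (h.snoc q).init = h := by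
  funext s
  simp [Hist.init, Hist.snoc]

@[simp] lemma Hist.last_snoc (h : Hist m t) (q : Fin (m t)) : (h.snoc q).last = q := by
  simp [Hist.last, Hist.snoc]

@[simp] lemma Hist.snoc_init_last (h : Hist m (t + 1)) : h.init.snoc h.last = h := by
  funext s
  refine Fin.lastCases ?_ (fun s => ?_) s
  · simp [Hist.last, Hist.snoc]
  · simp [Hist.init, Hist.snoc]

lemma Hist.snoc_eq_iff {h : Hist m t} {q : Fin (m t)} {h' : Hist m (t + 1)} :
    h.snoc q = h' ↔ h = h'.init ∧ q = h'.last := by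
  constructor
  · rintro rfl; simp
  · rintro ⟨rfl, rfl⟩; simp

/-- A history splits into its initial part and its last output. -/
def Hist.snocEquiv : Hist m t × Fin (m t) ≃ Hist m (t + 1) where
  toFun p := p.1.snoc p.2
  invFun h := (h.init, h.last)
  left_inv p := by simp
  right_inv h := by simp

lemma Hist.sum_snoc {M : Type*} [AddCommMonoid M] (F : Hist m (t + 1) → M) :
    ∑ h, ∑ q, F (Hist.snoc h q) = ∑ h', F h' := by
  rw [← Fintype.sum_prod_type', ← Hist.snocEquiv.sum_comp]
  rfl

end Histories

/-! ### Normalization and conditioning of finite measures -/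

section Conditioning

variable {Z : Type*} [MeasurableSpace Z]

/-- A measure of total mass one, as a bundled probability measure. -/
def toProbabilityMeasure (μ : Measure Z) [h : IsProbabilityMeasure μ] : ProbabilityMeasure Z :=
  ⟨μ, h⟩

lemma probabilityMeasure_ext {μ ν : ProbabilityMeasure Z} (h : (μ : Measure Z) = ν) : μ = ν :=
  Subtype.ext h

open Classical in
/-- The probability measure proportional to a finite nonzero measure, with a default value. -/
noncomputable def normalizeOr (d : ProbabilityMeasure Z) (μ : Measure Z) : ProbabilityMeasure Z :=
  if h : IsFiniteMeasure μ ∧ μ ≠ 0 then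
    haveI := h.1
    haveI : NeZero μ := ⟨h.2⟩
    toProbabilityMeasure ((μ Set.univ)⁻¹ • μ)
  else d

lemma normalizeOr_of_ne_zero (d : ProbabilityMeasure Z) (μ : Measure Z) [h : IsFiniteMeasure μ]
    (hμ : μ ≠ 0) : (normalizeOr d μ : Measure Z) = (μ Set.univ)⁻¹ • μ := by
  rw [normalizeOr, dif_pos ⟨h, hμ⟩]
  rfl

@[simp] lemma normalizeOr_zero (d : ProbabilityMeasure Z) : normalizeOr d 0 = d :=
  dif_neg fun h => h.2 rfl

lemma smul_normalizeOr (d : ProbabilityMeasure Z) (μ : Measure Z) [h : IsFiniteMeasure μ]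
    (hμ : μ ≠ 0) : μ Set.univ • (normalizeOr d μ : Measure Z) = μ := by
  rw [normalizeOr_of_ne_zero d μ hμ, smul_smul, ENNReal.mul_inv_cancel, one_smul]
  · simpa using hμ
  · exact measure_ne_top _ _

lemma normalizeOr_smul (d : ProbabilityMeasure Z) (μ : Measure Z) [h : IsFiniteMeasure μ]
    (hμ : μ ≠ 0) {c : ℝ≥0∞} (hc : c ≠ 0) (hc' : c ≠ ∞) :
    normalizeOr d (c • μ) = normalizeOr d μ := by
  have : IsFiniteMeasure (c • μ) := μ.smul_finite hc'
  have h0 : c • μ ≠ 0 := by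
    rw [Ne, ← Measure.measure_univ_eq_zero]
    simp [hc, hμ]
  refine probabilityMeasure_ext ?_
  rw [normalizeOr_of_ne_zero _ _ h0, normalizeOr_of_ne_zero _ _ hμ, Measure.smul_apply, smul_eq_mul,
    smul_smul, ENNReal.mul_inv (Or.inl hc) (Or.inl hc'), mul_right_comm,
    ENNReal.inv_mul_cancel hc hc', one_mul]

/-- The law obtained from `μ` by conditioning on `s` (when `s` is not null) and moving by `κ`. -/
noncomputable def condBind (κ : Kernel Z Z) [IsMarkovKernel κ] (s : Set Z)
    (μ : ProbabilityMeasure Z) : ProbabilityMeasure Z :=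
  normalizeOr (toProbabilityMeasure ((μ : Measure Z).bind κ)) (((μ : Measure Z).restrict s).bind κ)

lemma bind_apply_univ (κ : Kernel Z Z) [IsMarkovKernel κ] (μ : Measure Z) :
    μ.bind κ Set.univ = μ Set.univ := by
  rw [Measure.bind_apply MeasurableSet.univ κ.aemeasurable]
  simp

lemma bind_ne_zero_iff (κ : Kernel Z Z) [IsMarkovKernel κ] (μ : Measure Z) :
    μ.bind κ ≠ 0 ↔ μ ≠ 0 := by
  rw [Ne, ← Measure.measure_univ_eq_zero, bind_apply_univ, Measure.measure_univ_eq_zero]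

instance isFiniteMeasure_bind (κ : Kernel Z Z) [IsMarkovKernel κ] (μ : Measure Z)
    [IsFiniteMeasure μ] : IsFiniteMeasure (μ.bind κ) :=
  ⟨by rw [bind_apply_univ]; exact measure_lt_top _ _⟩

lemma measurable_condBind (κ : Kernel Z Z) [IsMarkovKernel κ] {s : Set Z} (hs : MeasurableSet s) :
    Measurable (condBind κ s) := by
  classical
  have hcoe : ∀ B : Set Z, MeasurableSet B →
      Measurable (fun μ : ProbabilityMeasure Z => (μ : Measure Z) B) := fun B hB =>
    (Measure.measurable_coe hB).comp measurable_subtype_coe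
  have hint : ∀ (g : Z → ℝ≥0∞), Measurable g →
      Measurable (fun μ : ProbabilityMeasure Z => ∫⁻ z, g z ∂(μ : Measure Z)) := fun g hg =>
    (Measure.measurable_lintegral hg).comp measurable_subtype_coe
  refine Measurable.subtype_mk (f := fun μ => (condBind κ s μ : Measure Z)) ?_
  refine Measure.measurable_of_measurable_coe _ fun B hB => ?_
  -- An explicit formula, split by whether the conditioning set is null; the null branch is the
  -- default law.
  have heq : ∀ μ : ProbabilityMeasure Z, (condBind κ s μ : Measure Z) B =
      if (μ : Measure Z) s = 0 then ∫⁻ z, κ z B ∂(μ : Measure Z) else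
        ((μ : Measure Z) s)⁻¹ * ∫⁻ z, s.indicator (fun z => κ z B) z ∂(μ : Measure Z) := by
    intro μ
    split_ifs with h
    · have : ((μ : Measure Z).restrict s).bind κ = 0 := by
        by_contra hne
        exact ((bind_ne_zero_iff κ _).1 hne) (Measure.restrict_eq_zero.2 h)
      rw [condBind, this, normalizeOr_zero]
      exact Measure.bind_apply hB κ.aemeasurable
    · rw [condBind, normalizeOr_of_ne_zero, bind_apply_univ, Measure.smul_apply,
        Measure.bind_apply hB κ.aemeasurable, Measure.restrict_apply_univ, lintegral_indicator hs,
        smul_eq_mul]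
      rw [bind_ne_zero_iff]
      exact fun hc => h (Measure.restrict_eq_zero.1 hc)
  simp_rw [heq]
  refine Measurable.ite (hcoe s hs (measurableSet_singleton 0)) (hint _ (κ.measurable_coe hB)) ?_
  exact (hcoe s hs).inv.mul (hint _ ((κ.measurable_coe hB).indicator hs))

end Conditioning

/-! ### Laws of the belief on output histories, and the controlled Markov chain -/

namespace Source

variable {Ω : Type*} [MeasurableSpace Ω] {P : Measure Ω}
  {X Y W R : Type*} [MeasurableSpace X] [MeasurableSpace Y] [MeasurableSpace W] [MeasurableSpace R]
  {m : ℕ → ℕ}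

lemma qHist_succ (S : Source P X Y W R) (Γ : CompositePolicy Y m) (t : ℕ) (ω : Ω) :
    S.qHist Γ (t + 1) ω =
      (S.qHist Γ t ω).snoc (Γ.map t (S.yHist t ω) (S.qHist Γ t ω)) := rfl

lemma comap_yHist_le (S : Source P X Y W R) (t : ℕ) :
    MeasurableSpace.comap (S.yHist t) inferInstance ≤
      MeasurableSpace.comap (S.yHist (t + 1)) inferInstance := by
  rw [← measurable_iff_comap_le]
  have : S.yHist t = (fun η : Fin (t + 2) → Y => Fin.init (α := fun _ => Y) η) ∘
      S.yHist (t + 1) := rfl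
  rw [this]
  exact (measurable_pi_lambda _ fun i => measurable_pi_apply _).comp (comap_measurable _)

/-- Both claims are carried together: the outputs through time `t` are determined by `y_[0,t]`, and
enlarging the σ-algebra to that of `y_[0,t+1]` starts the next step. -/
lemma measurable_qHist_comap (S : Source P X Y W R) (Γ : CompositePolicy Y m) (t : ℕ) :
    Measurable[MeasurableSpace.comap (S.yHist t) inferInstance] (S.qHist Γ t) ∧
    Measurable[MeasurableSpace.comap (S.yHist t) inferInstance] (S.qHist Γ (t + 1)) := by
  have step : ∀ t, Measurable[MeasurableSpace.comap (S.yHist t) inferInstance] (S.qHist Γ t) →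
      Measurable[MeasurableSpace.comap (S.yHist t) inferInstance] (S.qHist Γ (t + 1)) := by
    intro t ht
    have hs : Measurable (fun p : Hist m t × Fin (m t) => p.1.snoc p.2) := Measurable.of_discrete
    exact hs.comp (ht.prodMk ((Γ.measurable_map t).comp ((comap_measurable _).prodMk ht)))
  induction t with
  | zero => exact ⟨measurable_const, step 0 measurable_const⟩
  | succ t ih =>
    have h := ih.2.mono (S.comap_yHist_le t) le_rfl
    exact ⟨h, step _ h⟩

lemma measurable_qHist (S : Source P X Y W R) (Γ : CompositePolicy Y m) (t : ℕ) :
    Measurable (S.qHist Γ t) :=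
  (S.measurable_qHist_comap Γ t).1.mono (S.measurable_yHist t).comap_le le_rfl

lemma preimage_qHist_succ (S : Source P X Y W R) (Γ : CompositePolicy Y m) (t : ℕ) (h : Hist m t)
    (q : Fin (m t)) : S.qHist Γ (t + 1) ⁻¹' {h.snoc q} =
      S.qHist Γ t ⁻¹' {h} ∩ {ω | Γ.map t (S.yHist t ω) h = q} := by
  ext ω
  simp only [Set.mem_preimage, Set.mem_singleton_iff, Set.mem_inter_iff, Set.mem_ofPred_eq,
    qHist_succ, Hist.snoc_eq_iff, Hist.init_snoc, Hist.last_snoc]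
  constructor
  · rintro ⟨rfl, h⟩; exact ⟨rfl, h⟩
  · rintro ⟨rfl, h⟩; exact ⟨rfl, h⟩

section Laws

variable [TopologicalSpace X] [PolishSpace X] [BorelSpace X] [Nonempty X] [IsProbabilityMeasure P]

/-- The law of `π_t` on the event `q_[0,t-1] = h`. -/
noncomputable def priorLaw (S : Source P X Y W R) (Γ : CompositePolicy Y m) (t : ℕ) (h : Hist m t) :
    Measure (ProbabilityMeasure X) :=
  (P.restrict (S.qHist Γ t ⁻¹' {h})).map (S.π t)

/-- The law of `π_t` on the event `q_[0,t] = h`. -/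
noncomputable def postLaw (S : Source P X Y W R) (Γ : CompositePolicy Y m) (t : ℕ)
    (h : Hist m (t + 1)) : Measure (ProbabilityMeasure X) :=
  (P.restrict (S.qHist Γ (t + 1) ⁻¹' {h})).map (S.π t)

variable (S : Source P X Y W R) (Γ : CompositePolicy Y m)

instance isFiniteMeasure_priorLaw (t : ℕ) (h : Hist m t) : IsFiniteMeasure (S.priorLaw Γ t h) :=
  inferInstanceAs (IsFiniteMeasure (Measure.map _ _))

instance isFiniteMeasure_postLaw (t : ℕ) (h : Hist m (t + 1)) :
    IsFiniteMeasure (S.postLaw Γ t h) :=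
  inferInstanceAs (IsFiniteMeasure (Measure.map _ _))

lemma priorLaw_univ (t : ℕ) (h : Hist m t) :
    S.priorLaw Γ t h Set.univ = P (S.qHist Γ t ⁻¹' {h}) := by
  rw [priorLaw, Measure.map_apply (S.measurable_π t) MeasurableSet.univ]
  simp

lemma priorLaw_ne_zero_iff (t : ℕ) (h : Hist m t) :
    S.priorLaw Γ t h ≠ 0 ↔ P (S.qHist Γ t ⁻¹' {h}) ≠ 0 := by
  rw [← S.priorLaw_univ Γ t h, Ne, Ne, Measure.measure_univ_eq_zero]

lemma priorLaw_succ [MeasurableSpace.CountablyGenerated Y] (t : ℕ) (h : Hist m (t + 1)) :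
    S.priorLaw Γ (t + 1) h = (S.postLaw Γ t h).bind (S.beliefKernel t) :=
  S.map_π_succ t ((S.measurable_qHist_comap Γ t).2 (measurableSet_singleton h))

/-- This exhibits an arbitrary policy as a randomized quantization of the prior law, the input that
purification needs. -/
lemma sum_postLaw (t : ℕ) (h : Hist m t) :
    ∑ q, S.postLaw Γ t (h.snoc q) = S.priorLaw Γ t h := by
  ext B hB
  have hm : ∀ q, MeasurableSet {ω | Γ.map t (S.yHist t ω) h = q} := fun q =>
    ((Γ.measurable_map t).comp ((S.measurable_yHist t).prodMk measurable_const))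
      (measurableSet_singleton q)
  have hq := S.measurable_qHist Γ t (measurableSet_singleton h)
  have hπ := S.measurable_π t hB
  simp only [Measure.finsetSum_apply, postLaw, priorLaw, Measure.map_apply (S.measurable_π t) hB,
    Measure.restrict_apply hπ, preimage_qHist_succ]
  rw [← measure_biUnion_finset]
  · congr 1
    ext ω
    simp
  · intro q _ q' _ hne
    refine Set.disjoint_left.2 fun ω h1 h2 => hne ?_
    exact h1.2.2.symm.trans h2.2.2
  · exact fun q _ => hπ.inter (hq.inter (hm q))

lemma postLaw_snoc {Q : (t : ℕ) → Hist m t → Quantizer (ProbabilityMeasure X) (m t)}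
    (hQ : S.AppliesQuantizers Γ Q) (t : ℕ) (h : Hist m t) (q : Fin (m t)) :
    S.postLaw Γ t (h.snoc q) = (S.priorLaw Γ t h).restrict ((Q t h).1 ⁻¹' {q}) := by
  have hs : MeasurableSet ((Q t h).1 ⁻¹' {q}) := (Q t h).2 (measurableSet_singleton q)
  ext B hB
  rw [Measure.restrict_apply hB, postLaw, priorLaw, Measure.map_apply (S.measurable_π t) hB,
    Measure.map_apply (S.measurable_π t) (hB.inter hs), Measure.restrict_apply (S.measurable_π t hB),
    Measure.restrict_apply (S.measurable_π t (hB.inter hs)), preimage_qHist_succ]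
  congr 1
  ext ω
  simp only [Set.mem_inter_iff, Set.mem_preimage, Set.mem_ofPred_eq, hQ t _ h, π]
  simp only [Set.mem_singleton_iff]
  tauto

/-- The law of `π_t`. -/
noncomputable def beliefLaw (t : ℕ) : ProbabilityMeasure (ProbabilityMeasure X) :=
  haveI := Measure.isProbabilityMeasure_map (μ := P) (S.measurable_π t).aemeasurable
  toProbabilityMeasure (P.map (S.π t))

lemma Ξ_eq_normalizeOr (t : ℕ) (h : Hist m t) :
    S.Ξ Γ t h = normalizeOr (S.beliefLaw t) (S.priorLaw Γ t h) := by
  by_cases hp : P (S.qHist Γ t ⁻¹' {h}) ≠ 0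
  · refine probabilityMeasure_ext ?_
    rw [normalizeOr_of_ne_zero _ _ ((S.priorLaw_ne_zero_iff Γ t h).2 hp), priorLaw_univ]
    refine (congrArg Subtype.val (dif_pos hp)).trans ?_
    simp [ProbabilityTheory.cond, priorLaw, Measure.map_smul]
  · have h0 : S.priorLaw Γ t h = 0 := by
      by_contra hc
      exact hp ((S.priorLaw_ne_zero_iff Γ t h).1 hc)
    rw [h0, normalizeOr_zero]
    exact dif_neg hp

lemma smul_Ξ (t : ℕ) (h : Hist m t) (hp : P (S.qHist Γ t ⁻¹' {h}) ≠ 0) :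
    P (S.qHist Γ t ⁻¹' {h}) • (S.Ξ Γ t h : Measure (ProbabilityMeasure X)) =
      S.priorLaw Γ t h := by
  rw [Ξ_eq_normalizeOr, ← priorLaw_univ]
  exact smul_normalizeOr _ _ ((S.priorLaw_ne_zero_iff Γ t h).2 hp)

variable [MeasurableSpace.CountablyGenerated Y]

/-- The new prior law is the probability of `h` times the conditioned and moved `Ξ_t`; that factor
cancels in the normalization. -/
lemma Ξ_succ {Q : (t : ℕ) → Hist m t → Quantizer (ProbabilityMeasure X) (m t)}
    (hQ : S.AppliesQuantizers Γ Q) (t : ℕ) (h : Hist m t) (q : Fin (m t))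
    (hp : P (S.qHist Γ (t + 1) ⁻¹' {h.snoc q}) ≠ 0) :
    S.Ξ Γ (t + 1) (h.snoc q) = condBind (S.beliefKernel t) ((Q t h).1 ⁻¹' {q}) (S.Ξ Γ t h) := by
  have hp' : P (S.qHist Γ t ⁻¹' {h}) ≠ 0 := fun h0 => hp <| by
    rw [preimage_qHist_succ]
    exact measure_mono_null Set.inter_subset_left h0
  have hne := (S.priorLaw_ne_zero_iff Γ (t + 1) (h.snoc q)).2 hp
  have hlaw : S.priorLaw Γ (t + 1) (h.snoc q) = P (S.qHist Γ t ⁻¹' {h}) •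
      ((S.Ξ Γ t h : Measure _).restrict ((Q t h).1 ⁻¹' {q})).bind (S.beliefKernel t) := by
    rw [priorLaw_succ, S.postLaw_snoc Γ hQ, ← S.smul_Ξ Γ t h hp', Measure.restrict_smul,
      Measure.bind_smul]
  have hne' : ((S.Ξ Γ t h : Measure _).restrict ((Q t h).1 ⁻¹' {q})).bind
      (S.beliefKernel t) ≠ 0 := fun h0 => hne (by rw [hlaw, h0, smul_zero])
  -- `Ξ` and `condBind` have different default laws; on a nonzero measure the default plays no role.
  have h1 : ∀ d d' : ProbabilityMeasure (ProbabilityMeasure X),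
      ∀ μ : Measure (ProbabilityMeasure X), [IsFiniteMeasure μ] → μ ≠ 0 →
        normalizeOr d μ = normalizeOr d' μ := fun d d' μ hf hμ => probabilityMeasure_ext <| by
    rw [normalizeOr_of_ne_zero d μ hμ, normalizeOr_of_ne_zero d' μ hμ]
  rw [Ξ_eq_normalizeOr, hlaw, normalizeOr_smul _ _ hne' hp' (measure_ne_top _ _), condBind]
  exact h1 _ _ _ hne'

/-- The transition kernel of the conditional laws of the belief, for a given quantizer. -/
noncomputable def lawKernel (t : ℕ) {n : ℕ} (Q : Quantizer (ProbabilityMeasure X) n) :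
    Kernel (ProbabilityMeasure (ProbabilityMeasure X))
      (ProbabilityMeasure (ProbabilityMeasure X)) where
  toFun ξ := ∑ q, (ξ : Measure (ProbabilityMeasure X)) (Q.1 ⁻¹' {q}) •
    Measure.dirac (condBind (S.beliefKernel t) (Q.1 ⁻¹' {q}) ξ)
  measurable' := by
    refine Measure.measurable_of_measurable_coe _ fun B hB => ?_
    simp only [Measure.finsetSum_apply, Measure.smul_apply, smul_eq_mul, Measure.dirac_apply' _ hB]
    refine Finset.measurable_sum _ fun q _ => ?_
    have hs : MeasurableSet (Q.1 ⁻¹' {q}) := Q.2 (measurableSet_singleton q)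
    exact ((Measure.measurable_coe hs).comp measurable_subtype_coe).mul
      ((measurable_one.indicator hB).comp (measurable_condBind _ hs))

lemma lawKernel_apply (t : ℕ) {n : ℕ} (Q : Quantizer (ProbabilityMeasure X) n)
    (ξ : ProbabilityMeasure (ProbabilityMeasure X))
    {B : Set (ProbabilityMeasure (ProbabilityMeasure X))} (hB : MeasurableSet B) :
    S.lawKernel t Q ξ B = ∑ q, (ξ : Measure (ProbabilityMeasure X)) (Q.1 ⁻¹' {q}) *
      B.indicator 1 (condBind (S.beliefKernel t) (Q.1 ⁻¹' {q}) ξ) := by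
  change (∑ q, (ξ : Measure (ProbabilityMeasure X)) (Q.1 ⁻¹' {q}) •
    Measure.dirac (condBind (S.beliefKernel t) (Q.1 ⁻¹' {q}) ξ)) B = _
  simp only [Measure.finsetSum_apply, Measure.smul_apply, smul_eq_mul, Measure.dirac_apply' _ hB]

lemma sum_measure_preimage {Z : Type*} [MeasurableSpace Z] (μ : Measure Z) {n : ℕ}
    (Q : Quantizer Z n) : ∑ q, μ (Q.1 ⁻¹' {q}) = μ Set.univ := by
  rw [sum_measure_preimage_singleton _ fun q _ => Q.2 (measurableSet_singleton q)]
  simp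

instance isMarkovKernel_lawKernel (t : ℕ) {n : ℕ} (Q : Quantizer (ProbabilityMeasure X) n) :
    IsMarkovKernel (S.lawKernel t Q) := by
  refine ⟨fun ξ => ⟨?_⟩⟩
  rw [lawKernel_apply _ _ _ _ MeasurableSet.univ]
  simp only [Set.indicator_univ, Pi.one_apply, mul_one]
  rw [sum_measure_preimage]
  exact measure_univ

theorem isControlledMarkovChain (m : ℕ → ℕ) : S.IsControlledMarkovChain m := by
  classical
  refine ⟨fun t Q => S.lawKernel t Q, fun t Q => inferInstance, ?_⟩
  intro Γ Q hQ t h hp B hB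
  have hpt : P (S.qHist Γ t ⁻¹' {h}) ≠ ∞ := measure_ne_top _ _
  have hqm : ∀ q, MeasurableSet (S.qHist Γ (t + 1) ⁻¹' {h.snoc q}) := fun q =>
    S.measurable_qHist Γ (t + 1) (measurableSet_singleton _)
  have hset : S.qHist Γ t ⁻¹' {h} ∩ {ω | S.Ξ Γ (t + 1) (S.qHist Γ (t + 1) ω) ∈ B} =
      ⋃ q ∈ Finset.univ.filter (fun q => S.Ξ Γ (t + 1) (h.snoc q) ∈ B),
        S.qHist Γ (t + 1) ⁻¹' {h.snoc q} := by
    ext ω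
    simp only [Set.mem_inter_iff, Set.mem_preimage, Set.mem_singleton_iff, Set.mem_ofPred_eq,
      Finset.mem_filter, Finset.mem_univ, true_and, Set.mem_iUnion, exists_prop]
    constructor
    · rintro ⟨rfl, hω⟩
      exact ⟨_, hω, rfl⟩
    · rintro ⟨q, hω, hq⟩
      refine ⟨?_, by rwa [hq]⟩
      rw [qHist_succ, Hist.snoc_eq_iff] at hq
      simpa using hq.1
  rw [cond_apply (S.measurable_qHist Γ t (measurableSet_singleton h)), hset,
    measure_biUnion_finset _ fun q _ => hqm q, Finset.sum_filter, Finset.mul_sum,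
    lawKernel_apply _ _ _ _ hB]
  · refine Finset.sum_congr rfl fun q _ => ?_
    have hmass : P (S.qHist Γ (t + 1) ⁻¹' {h.snoc q}) = P (S.qHist Γ t ⁻¹' {h}) *
        (S.Ξ Γ t h : Measure _) ((Q t h).1 ⁻¹' {q}) := by
      rw [← priorLaw_univ, priorLaw_succ, bind_apply_univ, S.postLaw_snoc Γ hQ,
        Measure.restrict_apply_univ, ← S.smul_Ξ Γ t h hp, Measure.smul_apply, smul_eq_mul]
    -- After an output of probability zero `Ξ_succ` does not apply, but the weights on both sides
    -- vanish.
    by_cases h0 : P (S.qHist Γ (t + 1) ⁻¹' {h.snoc q}) = 0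
    · have : (S.Ξ Γ t h : Measure _) ((Q t h).1 ⁻¹' {q}) = 0 := by
        rw [h0] at hmass
        exact (mul_eq_zero.1 hmass.symm).resolve_left hp
      rw [this, h0]
      simp
    · rw [← S.Ξ_succ Γ hQ t h q h0, hmass]
      by_cases hb : S.Ξ Γ (t + 1) (h.snoc q) ∈ B
      · simp only [hb, if_true, Set.indicator_of_mem, Pi.one_apply, mul_one]
        rw [← mul_assoc, ENNReal.inv_mul_cancel hp hpt, one_mul]
      · simp [hb]
  · intro q _ q' _ hne
    refine Set.disjoint_left.2 fun ω h1 h2 => hne ?_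
    have := (Set.mem_singleton_iff.1 h1).symm.trans (Set.mem_singleton_iff.1 h2)
    simpa [Hist.snoc_eq_iff] using this

end Laws

end Source

/-! ### Dynamic programming over quantizers -/

section Value

variable {Z : Type*} [MeasurableSpace Z] {m : ℕ → ℕ}

/-- The cost over `n` stages from time `t` on, when the output history is `h` and the state has law
`μ` on this history: the selectors `D` choose the quantizers, the state moves by the kernels `κ`,
and each cell of the quantization of a law contributes its cost `ψ`. -/
noncomputable def value (κ : ℕ → Kernel Z Z) (ψ : ℕ → Measure Z → ℝ≥0∞)
    (D : (t : ℕ) → Hist m t → Quantizer Z (m t)) :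
    (n t : ℕ) → Hist m t → Measure Z → ℝ≥0∞
  | 0, _, _, _ => 0
  | n + 1, t, h, μ => ∑ q, (ψ t (μ.restrict ((D t h).1 ⁻¹' {q})) +
      value κ ψ D n (t + 1) (h.snoc q) ((μ.restrict ((D t h).1 ⁻¹' {q})).bind (κ t)))

/-- The selectors are fixed and indexed by the history, not by the law; hence each stage only
restricts, moves and adds, and the class is closed under these operations. -/
lemma isInfLinear_value {κ : ℕ → Kernel Z Z} {ψ : ℕ → Measure Z → ℝ≥0∞}
    (hψ : ∀ t, IsInfLinear (ψ t)) (D : (t : ℕ) → Hist m t → Quantizer Z (m t)) (n t : ℕ)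
    (h : Hist m t) : IsInfLinear (value κ ψ D n t h) := by
  induction n generalizing t with
  | zero => exact IsInfLinear.zero
  | succ n ih =>
    refine IsInfLinear.sum Finset.univ
      (φ := fun q μ => ψ t (μ.restrict ((D t h).1 ⁻¹' {q})) +
        value κ ψ D n (t + 1) (h.snoc q) ((μ.restrict ((D t h).1 ⁻¹' {q})).bind (κ t)))
      fun q => ?_
    have hs : MeasurableSet ((D t h).1 ⁻¹' {q}) := (D t h).2 (measurableSet_singleton q)
    exact ((hψ t).restrict hs).add (((ih (t + 1) (h.snoc q)).bind (κ t)).restrict hs)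

lemma value_congr {κ : ℕ → Kernel Z Z} {ψ : ℕ → Measure Z → ℝ≥0∞}
    {D D' : (t : ℕ) → Hist m t → Quantizer Z (m t)} (n t : ℕ) (hD : ∀ s, t ≤ s → D s = D' s)
    (h : Hist m t) (μ : Measure Z) : value κ ψ D n t h μ = value κ ψ D' n t h μ := by
  induction n generalizing t μ with
  | zero => rfl
  | succ n ih =>
    simp only [value, hD t le_rfl]
    exact Finset.sum_congr rfl fun q _ => by
      rw [ih (t + 1) (fun s hs => hD s (by omega))]

end Value

namespace Source

variable {Ω : Type*} [MeasurableSpace Ω] {P : Measure Ω}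
  {X Y W R : Type*} [MeasurableSpace X] [MeasurableSpace Y] [MeasurableSpace W] [MeasurableSpace R]
  {m : ℕ → ℕ}
  [TopologicalSpace X] [PolishSpace X] [BorelSpace X] [Nonempty X] [IsProbabilityMeasure P]

/-- The cost of a policy over `n` stages from time `t` on, on the event that the output history
is `h`. -/
noncomputable def costToGo (S : Source P X Y W R) (Γ : CompositePolicy Y m)
    (ψ : ℕ → Measure (ProbabilityMeasure X) → ℝ≥0∞) : (n t : ℕ) → Hist m t → ℝ≥0∞
  | 0, _, _ => 0
  | n + 1, t, h => ∑ q, (ψ t (S.postLaw Γ t (h.snoc q)) + costToGo S Γ ψ n (t + 1) (h.snoc q))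

variable (S : Source P X Y W R)

lemma sum_costToGo (Γ : CompositePolicy Y m) (ψ : ℕ → Measure (ProbabilityMeasure X) → ℝ≥0∞)
    (n t : ℕ) : ∑ h, S.costToGo Γ ψ n t h =
      ∑ s ∈ Finset.Ico t (t + n), ∑ h, ψ s (S.postLaw Γ s h) := by
  induction n generalizing t with
  | zero => simp [costToGo]
  | succ n ih =>
    rw [Finset.sum_eq_sum_Ico_succ_bot (by omega), show t + (n + 1) = t + 1 + n by omega, ← ih]
    simp only [costToGo]
    rw [Hist.sum_snoc (fun h => ψ t (S.postLaw Γ t h) + S.costToGo Γ ψ n (t + 1) h),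
      Finset.sum_add_distrib]

lemma costToGo_zero (Γ : CompositePolicy Y m) (ψ : ℕ → Measure (ProbabilityMeasure X) → ℝ≥0∞)
    (n : ℕ) (h : Hist m 0) : S.costToGo Γ ψ n 0 h =
      ∑ s ∈ Finset.range n, ∑ h, ψ s (S.postLaw Γ s h) := by
  rw [Finset.range_eq_Ico, ← zero_add n, ← sum_costToGo, zero_add, Fintype.sum_unique]
  congr 1
  exact Subsingleton.elim _ _

lemma priorLaw_zero (Γ : CompositePolicy Y m) (h : Hist m 0) :
    S.priorLaw Γ 0 h = P.map (S.π 0) := by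
  have : S.qHist Γ 0 ⁻¹' {h} = Set.univ :=
    Set.eq_univ_of_forall fun ω => Subsingleton.elim _ _
  rw [priorLaw, this, Measure.restrict_univ]

variable [MeasurableSpace.CountablyGenerated Y]

/-- Backward induction: with later selectors fixed, stage cost plus continuation is concave in each
post-law, so purification yields a quantizer at time `t` for every history. -/
lemma exists_selectors_value_le [∀ t, Nonempty (Fin (m t))] (Γ : CompositePolicy Y m)
    {ψ : ℕ → Measure (ProbabilityMeasure X) → ℝ≥0∞} (hψ : ∀ t, IsInfLinear (ψ t)) (n t : ℕ) :
    ∃ D : (t : ℕ) → Hist m t → Quantizer (ProbabilityMeasure X) (m t),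
      ∀ h, value S.beliefKernel ψ D n t h (S.priorLaw Γ t h) ≤ S.costToGo Γ ψ n t h := by
  classical
  induction n generalizing t with
  | zero =>
    exact ⟨fun t _ => ⟨fun _ => Classical.arbitrary _, measurable_const⟩, fun h => le_rfl⟩
  | succ n ih =>
    obtain ⟨D, hD⟩ := ih (t + 1)
    have hex : ∀ h : Hist m t, ∃ Q : Quantizer (ProbabilityMeasure X) (m t), ∑ q,
        (ψ t ((S.priorLaw Γ t h).restrict (Q.1 ⁻¹' {q})) +
          value S.beliefKernel ψ D n (t + 1) (h.snoc q)
            (((S.priorLaw Γ t h).restrict (Q.1 ⁻¹' {q})).bind (S.beliefKernel t))) ≤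
        ∑ q, (ψ t (S.postLaw Γ t (h.snoc q)) + value S.beliefKernel ψ D n (t + 1) (h.snoc q)
          ((S.postLaw Γ t (h.snoc q)).bind (S.beliefKernel t))) := by
      intro h
      rw [← S.sum_postLaw Γ t h]
      exact exists_quantizer_sum_le (fun q => S.postLaw Γ t (h.snoc q))
        fun q => (hψ t).add ((isInfLinear_value hψ D n (t + 1) (h.snoc q)).bind (S.beliefKernel t))
    choose Q hQ using hex
    -- Only time `t` changes, so by `value_congr` the continuation value is unaffected.
    refine ⟨Function.update D t Q, fun h => ?_⟩
    simp only [value, Function.update_self, costToGo]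
    have hcongr : ∀ q μ, value S.beliefKernel ψ (Function.update D t Q) n (t + 1) (Hist.snoc h q) μ =
        value S.beliefKernel ψ D n (t + 1) (Hist.snoc h q) μ := fun q μ =>
      value_congr n (t + 1) (fun s hs => Function.update_of_ne (by omega) _ _) _ _
    simp only [hcongr]
    refine (hQ h).trans (Finset.sum_le_sum fun q _ => ?_)
    rw [← priorLaw_succ]
    gcongr
    exact hD _

/-- The laws of the belief on output histories that result when quantizers are selected by the
conditional law of the belief. -/
noncomputable def selectedLaw
    (Q : (t : ℕ) → ProbabilityMeasure (ProbabilityMeasure X) →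
      Quantizer (ProbabilityMeasure X) (m t)) :
    (t : ℕ) → Hist m t → Measure (ProbabilityMeasure X)
  | 0, _ => P.map (S.π 0)
  | t + 1, h => ((selectedLaw Q t h.init).restrict
      ((Q t (normalizeOr (S.beliefLaw t) (selectedLaw Q t h.init))).1 ⁻¹' {h.last})).bind
        (S.beliefKernel t)

/-- `Ξ_t` depends on the policy that is being defined from it. The circle is broken by computing the
laws forward in `selectedLaw` and then identifying them with the prior laws of the resulting policy.
-/
lemma exists_policy_of_selectors
    (Q : (t : ℕ) → ProbabilityMeasure (ProbabilityMeasure X) →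
      Quantizer (ProbabilityMeasure X) (m t)) :
    ∃ Γ : CompositePolicy Y m, S.AppliesQuantizers Γ fun t h => Q t (S.Ξ Γ t h) := by
  let Q' : (t : ℕ) → Hist m t → Quantizer (ProbabilityMeasure X) (m t) := fun t h =>
    Q t (normalizeOr (S.beliefLaw t) (S.selectedLaw Q t h))
  let Γ : CompositePolicy Y m :=
    { map := fun t η h => (Q' t h).1 (S.belief t η)
      measurable_map := fun t => measurable_from_prod_countable_left fun h =>
        (Q' t h).2.comp (S.measurable_belief t) }
  have hΓ : S.AppliesQuantizers Γ Q' := fun t η h => rfl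
  have hlaw : ∀ t h, S.priorLaw Γ t h = S.selectedLaw Q t h := by
    intro t
    induction t with
    | zero => exact fun h => S.priorLaw_zero Γ h
    | succ t ih =>
      intro h
      rw [← h.snoc_init_last, priorLaw_succ, S.postLaw_snoc Γ hΓ, ih]
      simp [selectedLaw, Q']
  refine ⟨Γ, fun t η h => ?_⟩
  have hQ : Q' t h = Q t (S.Ξ Γ t h) := by rw [Ξ_eq_normalizeOr, hlaw]
  exact congrArg (fun q : Quantizer (ProbabilityMeasure X) (m t) => q.1 (S.belief t η)) hQ

/-- The quantizer at `ξ` is the one selected by `D` at the label `b t ξ` of least value; the label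
need not be the actual output history. -/
theorem exists_usesOnlyBeliefs_sum_le (Γ : CompositePolicy Y m)
    {ψ : ℕ → Measure (ProbabilityMeasure X) → ℝ≥0∞} (hψ : ∀ t, IsInfLinear (ψ t)) (T : ℕ) :
    ∃ Γ' : CompositePolicy Y m, S.UsesOnlyBeliefs Γ' ∧
      ∑ t ∈ Finset.range T, ∑ h, ψ t (S.postLaw Γ' t h) ≤
        ∑ t ∈ Finset.range T, ∑ h, ψ t (S.postLaw Γ t h) := by
  obtain ⟨ω⟩ : Nonempty Ω := nonempty_of_isProbabilityMeasure P
  have hH : ∀ t, Nonempty (Hist m t) := fun t => ⟨S.qHist Γ t ω⟩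
  have hm : ∀ t, Nonempty (Fin (m t)) := fun t => ⟨(S.qHist Γ (t + 1) ω).last⟩
  obtain ⟨D, hD⟩ := S.exists_selectors_value_le Γ hψ T 0
  have hex : ∀ t, ∃ b : ProbabilityMeasure (ProbabilityMeasure X) → Hist m t, Measurable b ∧
      ∀ ξ h, value S.beliefKernel ψ D (T - t) t (b ξ) (ξ : Measure _) ≤
        value S.beliefKernel ψ D (T - t) t h (ξ : Measure _) := fun t =>
    exists_measurable_argmin fun h => (isInfLinear_value hψ D (T - t) t h).measurable
  choose b hb hmin using hex
  obtain ⟨Γ', hΓ'⟩ := S.exists_policy_of_selectors (fun t ξ => D t (b t ξ))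
  refine ⟨Γ', ⟨fun t ξ => D t (b t ξ), fun t => ?_, hΓ'⟩, ?_⟩
  · have h1 : Measurable (fun p : Hist m t × ProbabilityMeasure X => (D t p.1).1 p.2) :=
      measurable_from_prod_countable_right fun h => (D t h).2
    exact h1.comp (((hb t).comp measurable_fst).prodMk measurable_snd)
  · have key : ∀ n t, t + n = T → ∀ h, S.costToGo Γ' ψ n t h ≤
        value S.beliefKernel ψ D n t (b t (S.Ξ Γ' t h)) (S.priorLaw Γ' t h) := by
      intro n
      induction n with
      | zero => exact fun t _ h => le_rfl
      | succ n ih =>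
        intro t ht h
        simp only [costToGo, value]
        refine Finset.sum_le_sum fun q _ => ?_
        -- Expanding and folding back writes the cells on both sides as post-laws.
        rw [S.postLaw_snoc Γ' hΓ', ← S.postLaw_snoc Γ' hΓ', ← priorLaw_succ]
        refine add_le_add le_rfl ((ih (t + 1) (by omega) _).trans ?_)
        by_cases hp : P (S.qHist Γ' (t + 1) ⁻¹' {h.snoc q}) = 0
        · have h0 : S.priorLaw Γ' (t + 1) (h.snoc q) = 0 := by
            by_contra hc
            exact (S.priorLaw_ne_zero_iff Γ' _ _).1 hc hp
          rw [h0, (isInfLinear_value hψ D n (t + 1) _).map_zero]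
          exact zero_le
        · rw [← S.smul_Ξ Γ' _ _ hp,
            (isInfLinear_value hψ D n (t + 1) _).map_smul (measure_ne_top _ _),
            (isInfLinear_value hψ D n (t + 1) _).map_smul (measure_ne_top _ _)]
          -- The competitor is the old label extended by `q`, the continuation charged by `value`;
          -- the new best label does no worse.
          have := hmin (t + 1) (S.Ξ Γ' (t + 1) (h.snoc q)) ((b t (S.Ξ Γ' t h)).snoc q)
          rw [show T - (t + 1) = n by omega] at this
          gcongr
    let h₀ : Hist m 0 := S.qHist Γ 0 ω
    rw [← S.costToGo_zero Γ' ψ T h₀, ← S.costToGo_zero Γ ψ T h₀]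
    refine (key T 0 (zero_add T) h₀).trans (le_of_eq_of_le ?_ (hD h₀))
    rw [priorLaw_zero, priorLaw_zero]
    -- There is only one empty history, so the initial label is immaterial.
    congr 1
    exact Subsingleton.elim _ _

end Source

/-! ### Expected cost and the receiver -/

namespace Source

variable {Ω : Type*} [MeasurableSpace Ω] {P : Measure Ω}
  {X Y W R : Type*} [MeasurableSpace X] [MeasurableSpace Y] [MeasurableSpace W] [MeasurableSpace R]
  {m : ℕ → ℕ} {U : Type*}

/-- The expected total cost as an extended nonnegative number. -/
noncomputable def ecost (S : Source P X Y W R) (c : X → U → ℝ) (T : ℕ) (Γ : CompositePolicy Y m)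
    (γ : Receiver m U) : ℝ≥0∞ :=
  ∫⁻ ω, ∑ t ∈ Finset.range T, ENNReal.ofReal (c (S.x t ω) (γ t (S.qHist Γ (t + 1) ω))) ∂P

lemma measurable_stage_cost [MeasurableSpace U] (S : Source P X Y W R) {c : X → U → ℝ}
    (hc : Measurable (Function.uncurry c)) (Γ : CompositePolicy Y m) (γ : Receiver m U) (t : ℕ) :
    Measurable (fun ω => c (S.x t ω) (γ t (S.qHist Γ (t + 1) ω))) :=
  hc.comp ((S.measurable_x t).prodMk (Measurable.of_discrete.comp (S.measurable_qHist Γ (t + 1))))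

lemma cost_eq_toReal_ecost [MeasurableSpace U] (S : Source P X Y W R) {c : X → U → ℝ}
    (hc : Measurable (Function.uncurry c)) (hc0 : ∀ x u, 0 ≤ c x u) (T : ℕ)
    (Γ : CompositePolicy Y m) (γ : Receiver m U) :
    S.cost c T Γ γ = (S.ecost c T Γ γ).toReal := by
  rw [cost, integral_eq_lintegral_of_nonneg_ae, ecost]
  · congr 1
    exact lintegral_congr fun ω => ENNReal.ofReal_sum_of_nonneg fun t _ => hc0 _ _
  · exact Filter.Eventually.of_forall fun ω => Finset.sum_nonneg fun t _ => hc0 _ _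
  · exact (Finset.measurable_sum _ fun t _ =>
      S.measurable_stage_cost hc Γ γ t).aestronglyMeasurable

lemma ecost_ne_top [IsProbabilityMeasure P] (S : Source P X Y W R) {c : X → U → ℝ}
    (hcb : ∃ C : ℝ, ∀ x u, c x u ≤ C) (T : ℕ) (Γ : CompositePolicy Y m) (γ : Receiver m U) :
    S.ecost c T Γ γ ≠ ∞ := by
  obtain ⟨C, hC⟩ := hcb
  refine ne_top_of_le_ne_top (b := ∫⁻ _, ∑ t ∈ Finset.range T, ENNReal.ofReal C ∂P) ?_
    (lintegral_mono fun ω => Finset.sum_le_sum fun t _ => ENNReal.ofReal_le_ofReal (hC _ _))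
  simp [ENNReal.mul_eq_top]

lemma isOptimal_of_forall_exists_le (S : Source P X Y W R) {c : X → U → ℝ}
    (hc0 : ∀ x u, 0 ≤ c x u) (T : ℕ) {Γ Γ' : CompositePolicy Y m}
    (h : ∀ γ : Receiver m U, ∃ γ' : Receiver m U, S.cost c T Γ' γ' ≤ S.cost c T Γ γ)
    (hΓ : S.IsOptimal c T Γ) : S.IsOptimal c T Γ' := by
  have h0 : ∀ (Γ : CompositePolicy Y m) (γ : Receiver m U), 0 ≤ S.cost c T Γ γ := fun Γ γ =>
    integral_nonneg fun ω => Finset.sum_nonneg fun t _ => hc0 _ _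
  have hbdd : ∀ Γ : CompositePolicy Y m,
      BddBelow (Set.range fun γ : Receiver m U => S.cost c T Γ γ) := fun Γ =>
    ⟨0, by rintro _ ⟨γ, rfl⟩; exact h0 Γ γ⟩
  refine le_antisymm ?_ (ciInf_le ⟨0, ?_⟩ Γ')
  · refine le_of_le_of_eq ?_ hΓ
    rcases isEmpty_or_nonempty (Receiver m U) with hU | hU
    -- With no receivers, both infima are zero by convention.
    · simp [Real.iInf_of_isEmpty]
    · refine le_ciInf fun γ => ?_
      obtain ⟨γ', hγ'⟩ := h γ
      exact (ciInf_le (hbdd Γ') γ').trans hγ'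
  · rintro _ ⟨Γ, rfl⟩
    exact Real.iInf_nonneg fun γ => h0 Γ γ

variable [TopologicalSpace X] [PolishSpace X] [BorelSpace X] [Nonempty X] [IsProbabilityMeasure P]

lemma ecost_eq_sum [MeasurableSpace U] (S : Source P X Y W R) {c : X → U → ℝ}
    (hc : Measurable (Function.uncurry c)) (T : ℕ) (Γ : CompositePolicy Y m) (γ : Receiver m U) :
    S.ecost c T Γ γ = ∑ t ∈ Finset.range T, ∑ h,
      ∫⁻ z, ∫⁻ x, ENNReal.ofReal (c x (γ t h)) ∂(z : Measure X) ∂(S.postLaw Γ t h) := by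
  rw [ecost, lintegral_finsetSum _ fun t _ => (S.measurable_stage_cost hc Γ γ t).ennreal_ofReal]
  refine Finset.sum_congr rfl fun t _ => ?_
  have hq : ∀ h, MeasurableSet (S.qHist Γ (t + 1) ⁻¹' {h}) := fun h =>
    S.measurable_qHist Γ (t + 1) (measurableSet_singleton h)
  have huniv : (⋃ h ∈ (Finset.univ : Finset (Hist m (t + 1))), S.qHist Γ (t + 1) ⁻¹' {h}) =
      Set.univ := by
    ext ω
    simp
  rw [← setLIntegral_univ, ← huniv, lintegral_biUnion_finset _ fun h _ => hq h]
  · refine Finset.sum_congr rfl fun h _ => ?_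
    rw [postLaw, ← S.setLIntegral_x t ((S.measurable_qHist_comap Γ t).2 (measurableSet_singleton h))
      (h := fun x => ENNReal.ofReal (c x (γ t h)))
      (hc.comp measurable_prodMk_right).ennreal_ofReal]
    refine setLIntegral_congr_fun (hq h) fun ω hω => ?_
    rw [Set.mem_preimage, Set.mem_singleton_iff] at hω
    simp only [hω]
  · intro h _ h' _ hne
    exact Set.disjoint_left.2 fun ω h1 h2 => hne (Eq.trans (Eq.symm h1) h2)

variable [MeasurableSpace.CountablyGenerated Y]

/-- The infimum over `n` is the stage cost when the receiver plays optimally among the actions `u n`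
on each output history. -/
lemma exists_usesOnlyBeliefs_iInf_le [MeasurableSpace U] (S : Source P X Y W R) {c : X → U → ℝ}
    (hc : Measurable (Function.uncurry c)) (T : ℕ) (Γ : CompositePolicy Y m) (u : ℕ → U) :
    ∃ Γ' : CompositePolicy Y m, S.UsesOnlyBeliefs Γ' ∧
      ∑ t ∈ Finset.range T, ∑ h, ⨅ n,
        ∫⁻ z, ∫⁻ x, ENNReal.ofReal (c x (u n)) ∂(z : Measure X) ∂(S.postLaw Γ' t h) ≤
      ∑ t ∈ Finset.range T, ∑ h, ⨅ n,
        ∫⁻ z, ∫⁻ x, ENNReal.ofReal (c x (u n)) ∂(z : Measure X) ∂(S.postLaw Γ t h) :=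
  S.exists_usesOnlyBeliefs_sum_le Γ (ψ := fun _ μ => ⨅ n, ∫⁻ z, ∫⁻ x,
    ENNReal.ofReal (c x (u n)) ∂(z : Measure X) ∂μ) (fun _ => ⟨_, fun n =>
      (Measure.measurable_lintegral (hc.comp (measurable_prodMk_right
        (y := u n))).ennreal_ofReal).comp measurable_subtype_coe, fun _ => rfl⟩) T

/-- Every policy is dominated by one that uses only the beliefs. -/
theorem exists_usesOnlyBeliefs_ecost_le [MeasurableSpace U] (S : Source P X Y W R) {c : X → U → ℝ}
    (hc : Measurable (Function.uncurry c)) (T : ℕ) (Γ : CompositePolicy Y m) :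
    ∃ Γ' : CompositePolicy Y m, S.UsesOnlyBeliefs Γ' ∧
      ∀ γ : Receiver m U, ∃ γ' : Receiver m U, S.ecost c T Γ' γ' ≤ S.ecost c T Γ γ := by
  obtain ⟨ω⟩ : Nonempty Ω := nonempty_of_isProbabilityMeasure P
  rcases isEmpty_or_nonempty (Receiver m U) with hU | hU
  · obtain ⟨Γ', hΓ', -⟩ := S.exists_usesOnlyBeliefs_sum_le Γ (ψ := fun _ _ => 0)
      (fun _ => IsInfLinear.zero) T
    exact ⟨Γ', hΓ', fun γ => hU.elim γ⟩
  let F : CompositePolicy Y m → (t : ℕ) → Hist m (t + 1) → U → ℝ≥0∞ := fun Γ t h v =>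
    ∫⁻ z, ∫⁻ x, ENNReal.ofReal (c x v) ∂(z : Measure X) ∂(S.postLaw Γ t h)
  have hF : ∀ Γ γ, S.ecost c T Γ γ = ∑ t ∈ Finset.range T, ∑ h, F Γ t h (γ t h) :=
    S.ecost_eq_sum hc T
  by_cases hmin : ∃ γ₀ : Receiver m U, ∀ γ, S.ecost c T Γ γ₀ ≤ S.ecost c T Γ γ
  · obtain ⟨γ₀, hγ₀⟩ := hmin
    -- Finitely many actions, so the infima for `Γ'` are attained. The range `T + 1` keeps the set
    -- nonempty when `T = 0`.
    let A : Set U := ⋃ t ∈ Finset.range (T + 1), Set.range (γ₀ t)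
    have hAfin : A.Finite := (Finset.range (T + 1)).finite_toSet.biUnion fun t _ =>
      Set.finite_range _
    have hAne : A.Nonempty :=
      ⟨γ₀ 0 (S.qHist Γ 1 ω), Set.mem_biUnion (x := 0) (by simp) ⟨_, rfl⟩⟩
    obtain ⟨u, hu⟩ := hAfin.countable.exists_eq_range hAne
    obtain ⟨Γ', hΓ', hle⟩ := S.exists_usesOnlyBeliefs_iInf_le hc T Γ u
    refine ⟨Γ', hΓ', fun γ => ?_⟩
    have hatt : ∀ t h, ∃ n, F Γ' t h (u n) = ⨅ n, F Γ' t h (u n) := by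
      intro t h
      have hfin : (Set.range fun n => F Γ' t h (u n)).Finite := by
        rw [show (fun n => F Γ' t h (u n)) = F Γ' t h ∘ u from rfl, Set.range_comp, ← hu]
        exact hAfin.image _
      exact (Set.range_nonempty _).csInf_mem hfin
    choose n hn using hatt
    refine ⟨fun t h => u (n t h), le_trans ?_ (hγ₀ γ)⟩
    rw [hF, hF]
    simp only [hn]
    refine hle.trans (Finset.sum_le_sum fun t ht => Finset.sum_le_sum fun h _ => ?_)
    have hmem : γ₀ t h ∈ Set.range u := by
      rw [← hu]
      refine Set.mem_biUnion (x := t) ?_ ⟨h, rfl⟩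
      have := Finset.mem_range.1 ht
      simp only [Finset.coe_range, Set.mem_Iio]
      omega
    obtain ⟨k, hk⟩ := hmem
    rw [← hk]
    exact iInf_le _ k
  -- No receiver is optimal for `Γ`, so each cost strictly exceeds the infimum; this slack replaces
  -- attainment for `Γ'`.
  · push Not at hmin
    obtain ⟨v, -, hv, hmem⟩ := exists_seq_tendsto_sInf
      (Set.range_nonempty (fun γ : Receiver m U => S.ecost c T Γ γ)) (OrderBot.bddBelow _)
    choose γs hγs using hmem
    -- All actions used along a minimizing sequence of receivers.
    let A : Set U := Set.range fun p : ℕ × (Σ t, Hist m (t + 1)) => γs p.1 p.2.1 p.2.2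
    have hAne : A.Nonempty := ⟨_, ⟨(0, ⟨0, S.qHist Γ 1 ω⟩), rfl⟩⟩
    obtain ⟨u, hu⟩ := (Set.countable_range _ : A.Countable).exists_eq_range hAne
    obtain ⟨Γ', hΓ', hle⟩ := S.exists_usesOnlyBeliefs_iInf_le hc T Γ u
    refine ⟨Γ', hΓ', fun γ => ?_⟩
    have hinf : ∑ t ∈ Finset.range T, ∑ h, ⨅ n, F Γ t h (u n) ≤ ⨅ γ, S.ecost c T Γ γ := by
      refine ge_of_tendsto' hv fun k => ?_
      rw [← hγs k]
      dsimp only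
      rw [hF]
      refine Finset.sum_le_sum fun t _ => Finset.sum_le_sum fun h _ => ?_
      have hmem : γs k t h ∈ Set.range u := by
        rw [← hu]
        exact ⟨(k, ⟨t, h⟩), rfl⟩
      obtain ⟨j, hj⟩ := hmem
      rw [← hj]
      exact iInf_le _ j
    obtain ⟨γ₁, hγ₁⟩ := hmin γ
    have hlt : ∑ p ∈ (Finset.range T).sigma fun t => (Finset.univ : Finset (Hist m (t + 1))),
        ⨅ n, F Γ' p.1 p.2 (u n) < S.ecost c T Γ γ := by
      rw [Finset.sum_sigma]
      exact (hle.trans (hinf.trans (iInf_le _ γ₁))).trans_lt hγ₁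
    obtain ⟨f, hf⟩ := exists_sum_lt_of_sum_iInf_lt
      ((Finset.range T).sigma fun t => (Finset.univ : Finset (Hist m (t + 1))))
      (fun (p : Σ t, Hist m (t + 1)) n => F Γ' p.1 p.2 (u n)) hlt
    refine ⟨fun t h => u (f ⟨t, h⟩), ?_⟩
    rw [Finset.sum_sigma] at hf
    rw [hF Γ']
    exact hf.le

end Source

end CausalQuantization

open MeasureTheory CausalQuantization in
theorem theorem4 {Ω : Type*} [MeasurableSpace Ω] (P : Measure Ω) [IsProbabilityMeasure P]
    {X : Type*} [TopologicalSpace X] [PolishSpace X] [MeasurableSpace X] [BorelSpace X] [Nonempty X]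
    {Y : Type*} [TopologicalSpace Y] [PolishSpace Y] [MeasurableSpace Y] [BorelSpace Y]
    {W R : Type*} [MeasurableSpace W] [MeasurableSpace R]
    {U : Type*} [MeasurableSpace U]
    (S : Source P X Y W R) (m : ℕ → ℕ) (T : ℕ)
    (c : X → U → ℝ) (hc : Measurable (Function.uncurry c)) (hc0 : ∀ x u, 0 ≤ c x u)
    (hcb : ∃ C : ℝ, ∀ x u, c x u ≤ C) :
    (∀ Γ : CompositePolicy Y m, ∃ Γ' : CompositePolicy Y m,
      S.UsesOnlyBeliefs Γ' ∧
      (∀ γ : Receiver m U, ∃ γ' : Receiver m U, S.cost c T Γ' γ' ≤ S.cost c T Γ γ) ∧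
      (S.IsOptimal c T Γ → S.IsOptimal c T Γ')) ∧
    S.IsControlledMarkovChain m := by
  refine ⟨fun Γ => ?_, S.isControlledMarkovChain m⟩
  obtain ⟨Γ', hΓ', hle⟩ := S.exists_usesOnlyBeliefs_ecost_le hc T Γ
  have hcost : ∀ γ : Receiver m U, ∃ γ' : Receiver m U, S.cost c T Γ' γ' ≤ S.cost c T Γ γ := by
    intro γ
    obtain ⟨γ', hγ'⟩ := hle γ
    refine ⟨γ', ?_⟩
    rw [S.cost_eq_toReal_ecost hc hc0, S.cost_eq_toReal_ecost hc hc0]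
    exact ENNReal.toReal_mono (S.ecost_ne_top hcb T Γ γ) hγ'
  exact ⟨Γ', hΓ', hcost, S.isOptimal_of_forall_exists_le hc0 T hcost⟩
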